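/- Let $n>1$. A convex polytope means the boundary $P=\partial K$ of a bounded set $K=\{y\in\mathbb{R}^n:\langle u_i,y\rangle\le d_i,\ 1\le i\le s\}$ with non-empty interior, where the $u_i$ are unit vectors, the $d_i$ are real, and each bounding hyperplane $H_i=\{\langle u_i,y\rangle=d_i\}$ meets $K$ in an $(n-1)$-dimensional face. A homothet of $P$ centred at $x$ is a set $x+rP$ with $r\ne 0$. Let $\dim_M$ denote the upper Minkowski (box) dimension ($+\infty$ on unbounded sets) and $\dim_P$ the packing dimension. For $m\in\mathbb{N}$ let $f^M(m)$ and $f^P(m)$ be the infimum of $\dim_M A$, respectively $\dim_P A$, over the sets $A\subset\mathbb{R}$ that contain an $m$-term arithmetic progression with every common difference in $[0,1]$. Let $h_n^M(P)$ and $h_n^P(P)$ be the infimum of $\dim_M B$, respectively $\dim_P B$, over the sets $B\subset\mathbb{R}^n$ that contain a homothet of $P$ centred at each point of the segment $[0,1]\times\{0\}^{n-1}$, and let $g_n^M(P)$, $g_n^P(P)$ be the analogous infima for homothets centred at each point of the cube $[0,1]^n$. Let $F_k(N)$ be the size of the smallest set of integers that contains a $k$-term arithmetic progression with common difference $d$ for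 each $d\in\{1,\dots,N\}$; the arithmetic Kakeya conjecture (AKC) states that \[\lim_{k\to\infty}\lim_{N\to\infty}\frac{\log F_k(N)}{\log N}=1 .\] (1) Let $P$ be a convex polytope as above, none of whose bounding hyperplanes passes through the origin, and suppose that its faces carry real labels $j_i$ with $j_i d_i=(u_i)_1$ for all $i$ (that is, $d_i=(u_i)_1/j_i$ when $j_i\neq0$), such that the set of labels is an arithmetic progression of length $m$ (with non-zero common difference; several faces may share a label). Then $f^M(m)=f^P(m)=:f(m)$ and \[h_n^M(P)=h_n^P(P)=n-1+f(m).\] (2) There is a sequence of convex polytopes $(P_k)_{k\in\mathbb{N}}$ in $\mathbb{R}^n$ converging in the Hausdorff metric to the sphere $S^{n-1}$ such that AKC is equivalent to $h_n^M(P_k)\to n$ and also to $h_n^P(P_k)\to n$ as $k\to\infty$; moreover AKC implies $g_n^M(P_k)\to n$ and $g_n^P(P_k)\to n$. -/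

import Mathlib

open Filter Topology
open scoped NNReal ENNReal

noncomputable section

namespace HarmonicPolytope

/-! ### Minkowski and packing dimension -/

/-- Minkowski (upper box) dimension: `limsup_{ε → 0+} log N_E(ε) / log (1/ε)`, where `N_E(ε)` is
the least positive number of closed `ε`-balls covering `E`; it is `⊤` when `E` is not totally
bounded. -/
def dimM {X : Type*} [PseudoEMetricSpace X] (E : Set X) : EReal :=
  limsup (fun ε : ℝ≥0 =>
    ENNReal.log (max 1 (Metric.externalCoveringNumber ε E : ℝ≥0∞)) /
      ((Real.log (1 / (ε : ℝ)) : ℝ) : EReal)) (𝓝[>] 0)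

/-- Packing dimension, as modified upper box dimension. -/
def dimP {X : Type*} [PseudoEMetricSpace X] (E : Set X) : EReal :=
  ⨅ (s : ℕ → Set X) (_ : E ⊆ ⋃ j, s j), ⨆ j, dimM (s j)

/-! ### Arithmetic progressions -/

/-- `A` contains a `k`-term arithmetic progression with common difference `d`. -/
def ContainsAP {R : Type*} [Semiring R] (k : ℕ) (d : R) (A : Set R) : Prop :=
  ∃ a : R, ∀ i : ℕ, i < k → a + (i : R) * d ∈ A

/-- `F_k(N)`: the least size of a set of integers containing a `k`-term arithmetic progression
with common difference `d` for each `d ∈ {1, …, N}`. -/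
def apNumber (k N : ℕ) : ℕ :=
  sInf {c : ℕ | ∃ A : Finset ℤ, A.card = c ∧
    ∀ d : ℕ, 1 ≤ d → d ≤ N → ContainsAP k (d : ℤ) (A : Set ℤ)}

/-- The arithmetic Kakeya conjecture: `lim_{k → ∞} lim_{N → ∞} log F_k(N) / log N = 1`. -/
def ArithmeticKakeya : Prop :=
  ∃ L : ℕ → ℝ,
    (∀ k : ℕ, 1 ≤ k →
      Tendsto (fun N : ℕ => Real.log (apNumber k N) / Real.log N) atTop (𝓝 (L k))) ∧
    Tendsto L atTop (𝓝 1)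

/-- `A ⊆ ℝ` contains a `k`-term arithmetic progression with every common difference in `[0,1]`. -/
def IsAPSet (k : ℕ) (A : Set ℝ) : Prop :=
  ∀ t ∈ Set.Icc (0 : ℝ) 1, ContainsAP k t A

/-- `f^M(k)`. -/
def fM (k : ℕ) : EReal := ⨅ (A : Set ℝ) (_ : IsAPSet k A), dimM A

/-- `f^P(k)`. -/
def fP (k : ℕ) : EReal := ⨅ (A : Set ℝ) (_ : IsAPSet k A), dimP A

/-! ### Polytopes -/

/-- The intersection of the half-spaces `⟨u i, y⟩ ≤ d i`. -/
def body {n s : ℕ} (u : Fin s → EuclideanSpace ℝ (Fin n)) (d : Fin s → ℝ) :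
    Set (EuclideanSpace ℝ (Fin n)) :=
  {y | ∀ i, inner ℝ (u i) y ≤ d i}

/-- The hyperplane with normal `u` and signed distance `d` from the origin. -/
def hyperplane {n : ℕ} (u : EuclideanSpace ℝ (Fin n)) (d : ℝ) :
    Set (EuclideanSpace ℝ (Fin n)) :=
  {y | inner ℝ u y = d}

/-- `P` is the boundary of a convex polytope (a bounded intersection of finitely many half-spaces
with non-empty interior), whose bounding hyperplanes are the hyperplanes with outward unit normals
`u i` and signed distances `d i` from the origin; each of them carries an `(n-1)`-dimensional
face. -/
structure IsPolytopeWith {n s : ℕ} (u : Fin s → EuclideanSpace ℝ (Fin n)) (d : Fin s → ℝ)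
    (P : Set (EuclideanSpace ℝ (Fin n))) : Prop where
  norm_normal : ∀ i, ‖u i‖ = 1
  bounded : Bornology.IsBounded (body u d)
  interior_nonempty : (interior (body u d)).Nonempty
  facet : ∀ i, Module.finrank ℝ (vectorSpan ℝ (body u d ∩ hyperplane (u i) (d i))) + 1 = n
  eq_frontier : P = frontier (body u d)

/-- `P` is (the boundary of) a convex polytope. -/
def IsConvexPolytope {n : ℕ} (P : Set (EuclideanSpace ℝ (Fin n))) : Prop :=
  ∃ (s : ℕ) (u : Fin s → EuclideanSpace ℝ (Fin n)) (d : Fin s → ℝ), IsPolytopeWith u d P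

/-- The faces of the polytope carry labels `j i`, whose values form an arithmetic progression of
length `m` of real numbers, such that `j i * d i` is the first coordinate of `u i`. No bounding
hyperplane passes through the origin. Distinct faces may share a label. -/
structure IsHarmonic {n s : ℕ} [NeZero n] (u : Fin s → EuclideanSpace ℝ (Fin n)) (d : Fin s → ℝ)
    (j : Fin s → ℝ) (m : ℕ) : Prop where
  dist_ne_zero : ∀ i, d i ≠ 0
  progression : ∃ a q : ℝ, q ≠ 0 ∧ Set.range j = {t | ∃ l : ℕ, l < m ∧ t = a + l * q}
  first_coord : ∀ i, j i * d i = u i 0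

/-! ### Sets containing homothets -/

/-- For each `x ∈ S`, the set `B` contains a homothet `x + r • P`, `r ≠ 0`, centred at `x`. -/
def ContainsHomothets {n : ℕ} (P S B : Set (EuclideanSpace ℝ (Fin n))) : Prop :=
  ∀ x ∈ S, ∃ r : ℝ, r ≠ 0 ∧ ∀ y ∈ P, x + r • y ∈ B

/-- The segment `[0,1] × {0}^{n-1}`. -/
def unitSegment (n : ℕ) [NeZero n] : Set (EuclideanSpace ℝ (Fin n)) :=
  {x | x 0 ∈ Set.Icc (0 : ℝ) 1 ∧ ∀ i, i ≠ 0 → x i = 0}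

/-- The cube `[0,1]^n`. -/
def unitCube (n : ℕ) : Set (EuclideanSpace ℝ (Fin n)) :=
  {x | ∀ i, x i ∈ Set.Icc (0 : ℝ) 1}

/-- The infimum of `dimM B` over sets `B` containing a homothet of `P` centred at each point
of `S`. -/
def leastDimM {n : ℕ} (P S : Set (EuclideanSpace ℝ (Fin n))) : EReal :=
  ⨅ (B : Set (EuclideanSpace ℝ (Fin n))) (_ : ContainsHomothets P S B), dimM B

/-- The infimum of `dimP B` over sets `B` containing a homothet of `P` centred at each point
of `S`. -/
def leastDimP {n : ℕ} (P S : Set (EuclideanSpace ℝ (Fin n))) : EReal :=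
  ⨅ (B : Set (EuclideanSpace ℝ (Fin n))) (_ : ContainsHomothets P S B), dimP B

/-- `h_n^M(P)`. -/
def hM {n : ℕ} [NeZero n] (P : Set (EuclideanSpace ℝ (Fin n))) : EReal :=
  leastDimM P (unitSegment n)

/-- `h_n^P(P)`. -/
def hP {n : ℕ} [NeZero n] (P : Set (EuclideanSpace ℝ (Fin n))) : EReal :=
  leastDimP P (unitSegment n)

/-- `g_n^M(P)`. -/
def gM {n : ℕ} (P : Set (EuclideanSpace ℝ (Fin n))) : EReal := leastDimM P (unitCube n)

/-- `g_n^P(P)`. -/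
def gP {n : ℕ} (P : Set (EuclideanSpace ℝ (Fin n))) : EReal := leastDimP P (unitCube n)

end HarmonicPolytope

end

namespace HarmonicPolytope

/-! ### Polynomial bounds on covering numbers -/

section BoxBound

variable {X Y : Type*} [PseudoMetricSpace X] [PseudoMetricSpace Y]

/-! Place the centre at parameter `t` of the segment. The `i`-th face of the homothet with ratio `r`
lies in the hyperplane at signed distance `t * u i 0 + r * d i`, which equals `d i * (t * j i + r)`
because `j i * d i = u i 0`. Divided by `d i`, these distances run over `t * j i + r`, an `m`-term
progression whose difference is proportional to `t`. Homothets at all centres of the segment thus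
correspond to progressions with all differences, times `n - 1` free dimensions along the faces.

For the upper bound, slabs over scaled copies of a progression set contain all the homothets
(`exists_containsHomothets`, `BoxBound.slab`). For the lower bound, each facet contains a disc, and
counting separated points in parallel discs recovers the box exponent of the set of distances
(`BoxBound.of_discs`). Packing dimension allows countable decompositions. Baire's theorem picks one
piece that serves a somewhere dense set of parameters, taking closures fills an interval of
differences, and geometric rescaling fills `[0, 1]` at arbitrarily small cost in the exponent
(`fM_le_of_somewhere_dense`). This gives `fM = fP` and, in `le_hP`, the lower bound already for
packing dimension. The exponent is handled through `BoxBound`, whose explicit constant is stable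
under finite unions, closures and Lipschitz images.

For the arithmetic Kakeya conjecture, `fM k` is exactly the limit of `log F_k(N) / log N`:
discretising at scale `1 / N` gives one inequality, and a self-similar set with digits in an optimal
integer set gives the other. The conjecture therefore says `fM k → 1`, and since `fM` is monotone,
any sequence of lengths tending to infinity detects it. Polytopes circumscribed about the sphere
have `d i = 1`, so their labels are the first coordinates of the normals. A fine net of normals with
first coordinates in a progression gives the required sequence. For centres in the cube, the value
lies between that for the segment and `n`. -/

/-- For every `ε < 1` the set `E` is covered by at most `C * ε ^ (-s)` closed `ε`-balls. -/
def BoxBound (E : Set X) (s : ℝ) : Prop :=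
  ∃ C : ℝ, 0 < C ∧ ∀ ε : ℝ, 0 < ε → ε < 1 →
    ∃ F : Finset X, (F.card : ℝ) ≤ C * ε ^ (-s) ∧ ∀ x ∈ E, ∃ y ∈ F, dist x y ≤ ε

lemma externalCoveringNumber_le_card {E : Set X} {ε : ℝ≥0} {F : Finset X}
    (h : ∀ x ∈ E, ∃ y ∈ F, dist x y ≤ ε) :
    Metric.externalCoveringNumber ε E ≤ F.card := by
  have hc : Metric.IsCover ε E (F : Set X) := by
    intro x hx
    obtain ⟨y, hy, hxy⟩ := h x hx
    refine ⟨y, hy, ?_⟩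
    simp only [Set.mem_ofPred_eq]
    rw [edist_nndist]
    exact_mod_cast hxy
  simpa using hc.externalCoveringNumber_le_encard

lemma exists_finset_of_externalCoveringNumber_lt_top {E : Set X} {ε : ℝ≥0}
    (h : Metric.externalCoveringNumber ε E < ⊤) :
    ∃ F : Finset X, (F.card : ℕ∞) = Metric.externalCoveringNumber ε E ∧
      ∀ x ∈ E, ∃ y ∈ F, dist x y ≤ ε := by
  have hne : Nonempty {C : Set X // Metric.IsCover ε E C} := ⟨⟨E, by simp⟩⟩
  obtain ⟨⟨C, hC⟩, hCe⟩ := ENat.exists_eq_iInf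
    (fun C : {C : Set X // Metric.IsCover ε E C} => C.1.encard)
  have heq : C.encard = Metric.externalCoveringNumber ε E := by
    rw [Metric.externalCoveringNumber, hCe, iInf_subtype]
  have hfin : C.Finite := by
    rw [← Set.encard_lt_top_iff, heq]; exact h
  refine ⟨hfin.toFinset, ?_, fun x hx => ?_⟩
  · rw [← heq, hfin.encard_eq_coe_toFinset_card]
  · obtain ⟨y, hy, hxy⟩ := hC hx
    refine ⟨y, by simpa using hy, ?_⟩
    simp only [Set.mem_ofPred_eq] at hxy
    rw [edist_nndist] at hxy
    exact_mod_cast hxy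

lemma eventually_mem_Ioo (δ : ℝ≥0) (hδ : 0 < δ) : ∀ᶠ ε : ℝ≥0 in 𝓝[>] 0, 0 < ε ∧ ε < δ :=
  Ioo_mem_nhdsGT hδ

lemma dimM_nonneg (E : Set X) : 0 ≤ dimM E := by
  have hne : (𝓝[>] (0 : ℝ≥0)).NeBot := inferInstance
  refine le_limsup_of_frequently_le (Eventually.frequently ?_) (by isBoundedDefault)
  filter_upwards [eventually_mem_Ioo 1 one_pos] with ε hε
  have h1 : (0 : ℝ) < ε := by exact_mod_cast hε.1
  have h2 : (ε : ℝ) < 1 := by exact_mod_cast hε.2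
  refine EReal.div_nonneg ?_ ?_
  · simp
  · have : 0 ≤ Real.log (1 / (ε : ℝ)) := Real.log_nonneg (by rw [le_div_iff₀ h1]; linarith)
    exact EReal.coe_nonneg.2 this

lemma dimM_empty : dimM (∅ : Set X) = 0 := by
  simp [dimM]

/-- A polynomial covering bound bounds the Minkowski dimension. -/
lemma BoxBound.dimM_le {E : Set X} {s : ℝ} (hs : 0 ≤ s) (h : BoxBound E s) : dimM E ≤ s := by
  obtain ⟨C, hC, hF⟩ := h
  refine EReal.le_of_forall_lt_iff_le.1 fun z hz => ?_
  have hz' : s < z := by exact_mod_cast hz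
  refine limsup_le_of_le (by isBoundedDefault) ?_
  -- The gap `z - s` absorbs the constant: `C * ε ^ (z - s)` is eventually at most `1`.
  have htend : Tendsto (fun ε : ℝ≥0 => (ε : ℝ) ^ (z - s)) (𝓝[>] 0) (𝓝 0) := by
    have : ContinuousAt (fun x : ℝ≥0 => (x : ℝ) ^ (z - s)) 0 :=
      (NNReal.continuous_coe.continuousAt).rpow_const (Or.inr (by linarith))
    have h0 : Tendsto (fun x : ℝ≥0 => (x : ℝ) ^ (z - s)) (𝓝 0) (𝓝 0) := by
      simpa [ContinuousAt, Real.zero_rpow (sub_pos.2 hz').ne'] using this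
    exact h0.mono_left nhdsWithin_le_nhds
  filter_upwards [eventually_mem_Ioo 1 one_pos,
    htend.eventually (gt_mem_nhds (show (0 : ℝ) < 1 / C by positivity))] with ε hε hsm
  have h1 : (0 : ℝ) < ε := by exact_mod_cast hε.1
  have h2 : (ε : ℝ) < 1 := by exact_mod_cast hε.2
  have hlog : 0 < Real.log (1 / (ε : ℝ)) := Real.log_pos (by rw [lt_div_iff₀ h1]; linarith)
  rw [EReal.div_le_iff_le_mul (by exact_mod_cast hlog) (EReal.coe_ne_top _)]
  obtain ⟨F, hFc, hcov⟩ := hF ε h1 h2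
  have hN := externalCoveringNumber_le_card (ε := ε) hcov
  have hpow : (F.card : ℝ) ≤ (ε : ℝ) ^ (-z) := by
    refine hFc.trans ?_
    have : (ε : ℝ) ^ (-s) = (ε : ℝ) ^ (z - s) * (ε : ℝ) ^ (-z) := by
      rw [← Real.rpow_add h1]; congr 1; ring
    rw [this, ← mul_assoc]
    have h3 : C * (ε : ℝ) ^ (z - s) ≤ 1 := by
      rw [lt_div_iff₀ hC] at hsm; linarith
    have := mul_le_mul_of_nonneg_right h3 (Real.rpow_nonneg h1.le (-z))
    linarith
  have hone : 1 ≤ (ε : ℝ) ^ (-z) :=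
    Real.one_le_rpow_of_pos_of_le_one_of_nonpos h1 h2.le (by linarith)
  have hmax : max 1 (Metric.externalCoveringNumber ε E : ℝ≥0∞) ≤
      ENNReal.ofReal ((ε : ℝ) ^ (-z)) := by
    refine max_le ?_ ?_
    · rw [← ENNReal.ofReal_one]; exact ENNReal.ofReal_le_ofReal hone
    · calc (Metric.externalCoveringNumber ε E : ℝ≥0∞) ≤ ((F.card : ℕ∞) : ℝ≥0∞) := by
            exact_mod_cast hN
        _ = ENNReal.ofReal (F.card : ℝ) := by simp
        _ ≤ _ := ENNReal.ofReal_le_ofReal hpow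
  refine (ENNReal.log_le_log hmax).trans ?_
  rw [ENNReal.log_ofReal_of_pos (by linarith), Real.log_rpow h1]
  rw [← EReal.coe_mul, EReal.coe_le_coe_iff, one_div, Real.log_inv]
  linarith

/-- A strict bound on the Minkowski dimension gives a polynomial covering bound. -/
lemma boxBound_of_dimM_lt {E : Set X} {s : ℝ} (h : dimM E < s) : BoxBound E s := by
  have hs : 0 < s := by exact_mod_cast (dimM_nonneg E).trans_lt h
  have hev := eventually_lt_of_limsup_lt h
  have hev' : ∀ᶠ ε : ℝ≥0 in 𝓝[>] 0, ∃ F : Finset X, (F.card : ℝ) ≤ (ε : ℝ) ^ (-s) ∧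
      ∀ x ∈ E, ∃ y ∈ F, dist x y ≤ ε := by
    filter_upwards [hev, eventually_mem_Ioo 1 one_pos] with ε hlt hε
    have h1 : (0 : ℝ) < ε := by exact_mod_cast hε.1
    have h2 : (ε : ℝ) < 1 := by exact_mod_cast hε.2
    have hlog : 0 < Real.log (1 / (ε : ℝ)) := Real.log_pos (by rw [lt_div_iff₀ h1]; linarith)
    rw [EReal.div_lt_iff (by exact_mod_cast hlog) (EReal.coe_ne_top _)] at hlt
    have hp : 0 < (ε : ℝ) ^ (-s) := Real.rpow_pos_of_pos h1 _
    have heq : ((s : EReal)) * ((Real.log (1 / (ε : ℝ)) : ℝ) : EReal) =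
        ENNReal.log (ENNReal.ofReal ((ε : ℝ) ^ (-s))) := by
      rw [ENNReal.log_ofReal_of_pos hp, Real.log_rpow h1, ← EReal.coe_mul, one_div, Real.log_inv]
      congr 1; ring
    rw [heq, ENNReal.log_lt_log_iff] at hlt
    have hlt' := (le_max_right _ _).trans_lt hlt
    have hfin : Metric.externalCoveringNumber ε E < ⊤ := by
      have : (Metric.externalCoveringNumber ε E : ℝ≥0∞) < ⊤ := hlt'.trans ENNReal.ofReal_lt_top
      exact_mod_cast this
    obtain ⟨F, hFc, hcov⟩ := exists_finset_of_externalCoveringNumber_lt_top hfin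
    refine ⟨F, ?_, hcov⟩
    rw [← hFc] at hlt'
    have h3 : ENNReal.ofReal (F.card : ℝ) < ENNReal.ofReal ((ε : ℝ) ^ (-s)) := by
      simpa using hlt'
    exact ((ENNReal.ofReal_lt_ofReal_iff hp).1 h3).le
  rw [eventually_nhdsWithin_iff, Metric.eventually_nhds_iff] at hev'
  obtain ⟨δ, hδ, hball⟩ := hev'
  have key : ∀ ε : ℝ, 0 < ε → ε < δ → ∃ F : Finset X, (F.card : ℝ) ≤ ε ^ (-s) ∧
      ∀ x ∈ E, ∃ y ∈ F, dist x y ≤ ε := fun ε h1 h2 => by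
    lift ε to ℝ≥0 using h1.le
    exact hball (by simpa [NNReal.dist_eq] using h2) (by exact_mod_cast h1)
  -- The limsup controls only scales below `δ`; one fixed cover at scale `δ / 2` serves all scales
  -- from `δ` to `1`.
  obtain ⟨F₀, hF₀, hcov₀⟩ := key (δ / 2) (by linarith) (by linarith)
  refine ⟨(δ / 2) ^ (-s) + 1, by positivity, fun ε h1 h2 => ?_⟩
  have hone : 1 ≤ ε ^ (-s) := Real.one_le_rpow_of_pos_of_le_one_of_nonpos h1 h2.le (by linarith)
  have hd : 0 < (δ / 2) ^ (-s) := by positivity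
  rcases lt_or_ge ε δ with hlt | hge
  · obtain ⟨F, hF, hcov⟩ := key ε h1 hlt
    exact ⟨F, by nlinarith, hcov⟩
  · refine ⟨F₀, by nlinarith, fun x hx => ?_⟩
    obtain ⟨y, hy, hxy⟩ := hcov₀ x hx
    exact ⟨y, hy, by linarith⟩

lemma dimP_le_dimM (E : Set X) : dimP E ≤ dimM E := by
  refine (iInf₂_le (fun _ => E) (Set.subset_iUnion (fun _ : ℕ => E) 0)).trans ?_
  simp

lemma BoxBound.mono {E E' : Set X} {s s' : ℝ} (h : BoxBound E s) (hE : E' ⊆ E) (hs : s ≤ s') :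
    BoxBound E' s' := by
  obtain ⟨C, hC, hF⟩ := h
  refine ⟨C, hC, fun ε h1 h2 => ?_⟩
  obtain ⟨F, hFc, hcov⟩ := hF ε h1 h2
  refine ⟨F, hFc.trans ?_, fun x hx => hcov x (hE hx)⟩
  exact mul_le_mul_of_nonneg_left
    (Real.rpow_le_rpow_of_exponent_ge h1 h2.le (by linarith)) hC.le

/-- A single point already needs one ball, whereas `C * ε ^ (-s)` would tend to `0` for negative
`s`. -/
lemma BoxBound.nonneg {E : Set X} {s : ℝ} (h : BoxBound E s) (hE : E.Nonempty) : 0 ≤ s := by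
  by_contra! hs
  obtain ⟨C, hC, hF⟩ := h
  obtain ⟨x, hx⟩ := hE
  have h0 : ContinuousAt (fun ε : ℝ => C * ε ^ (-s)) 0 :=
    continuousAt_const.mul (continuousAt_id.rpow_const (Or.inr (by linarith)))
  have h0' : Tendsto (fun ε : ℝ => C * ε ^ (-s)) (𝓝[>] 0) (𝓝 0) := by
    have h0'' : Tendsto (fun ε : ℝ => C * ε ^ (-s)) (𝓝 0) (𝓝 0) := by
      simpa [ContinuousAt, Real.zero_rpow (show -s ≠ 0 by linarith)] using h0
    exact h0''.mono_left nhdsWithin_le_nhds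
  obtain ⟨ε, hlt, h1, h2⟩ := ((h0'.eventually (gt_mem_nhds one_pos)).and
    (Ioo_mem_nhdsGT one_pos)).exists
  obtain ⟨F, hFc, hcov⟩ := hF ε h1 h2
  obtain ⟨y, hy, -⟩ := hcov x hx
  have : 1 ≤ F.card := Finset.card_pos.2 ⟨y, hy⟩
  have : (1 : ℝ) ≤ F.card := by exact_mod_cast this
  linarith

lemma boxBound_empty (s : ℝ) : BoxBound (∅ : Set X) s :=
  ⟨1, one_pos, fun ε h1 _ => ⟨∅, by simp; positivity, by simp⟩⟩

lemma BoxBound.union {E E' : Set X} {s : ℝ} (h : BoxBound E s) (h' : BoxBound E' s) :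
    BoxBound (E ∪ E') s := by
  classical
  obtain ⟨C, hC, hF⟩ := h
  obtain ⟨C', hC', hF'⟩ := h'
  refine ⟨C + C', by positivity, fun ε h1 h2 => ?_⟩
  obtain ⟨F, hFc, hcov⟩ := hF ε h1 h2
  obtain ⟨F', hFc', hcov'⟩ := hF' ε h1 h2
  refine ⟨F ∪ F', ?_, ?_⟩
  · have : ((F ∪ F').card : ℝ) ≤ F.card + F'.card := by exact_mod_cast Finset.card_union_le F F'
    linarith
  · rintro x (hx | hx)
    · obtain ⟨y, hy, hxy⟩ := hcov x hx
      exact ⟨y, Finset.mem_union_left _ hy, hxy⟩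
    · obtain ⟨y, hy, hxy⟩ := hcov' x hx
      exact ⟨y, Finset.mem_union_right _ hy, hxy⟩

lemma BoxBound.biUnion {ι : Type*} {E : ι → Set X} {s : ℝ} (I : Finset ι)
    (h : ∀ i ∈ I, BoxBound (E i) s) : BoxBound (⋃ i ∈ I, E i) s := by
  classical
  induction I using Finset.induction_on with
  | empty => simpa using boxBound_empty s
  | insert a I _ ih =>
    rw [Finset.set_biUnion_insert]
    exact (h a (Finset.mem_insert_self a I)).union
      (ih fun i hi => h i (Finset.mem_insert_of_mem hi))

lemma BoxBound.iUnion {ι : Type*} [Fintype ι] {E : ι → Set X} {s : ℝ}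
    (h : ∀ i, BoxBound (E i) s) : BoxBound (⋃ i, E i) s := by
  simpa using BoxBound.biUnion Finset.univ fun i _ => h i

lemma BoxBound.closure {E : Set X} {s : ℝ} (h : BoxBound E s) : BoxBound (closure E) s := by
  obtain ⟨C, hC, hF⟩ := h
  refine ⟨C, hC, fun ε h1 h2 => ?_⟩
  obtain ⟨F, hFc, hcov⟩ := hF ε h1 h2
  refine ⟨F, hFc, ?_⟩
  have hcl : IsClosed (⋃ y ∈ F, Metric.closedBall y ε) :=
    F.finite_toSet.isClosed_biUnion fun y _ => Metric.isClosed_closedBall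
  intro x hx
  have := closure_minimal (fun z hz => by simpa using hcov z hz) hcl hx
  simpa using this

lemma BoxBound.isBounded {E : Set X} {s : ℝ} (h : BoxBound E s) : Bornology.IsBounded E := by
  obtain ⟨C, hC, hF⟩ := h
  obtain ⟨F, hFc, hcov⟩ := hF (1 / 2) (by norm_num) (by norm_num)
  have : Bornology.IsBounded (⋃ y ∈ F, Metric.closedBall y (1 / 2)) := by
    rw [Bornology.isBounded_biUnion_finset]
    exact fun y _ => Metric.isBounded_closedBall
  exact this.subset fun z hz => by simpa using hcov z hz

/-- Shrinking the radius by a constant factor only changes the constant in the covering bound. -/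
lemma BoxBound.exists_scaled {E : Set X} {s : ℝ} (h : BoxBound E s) {K : ℝ} (hK : 1 ≤ K) :
    ∃ C : ℝ, 0 < C ∧ ∀ ε : ℝ, 0 < ε → ε < 1 →
      ∃ F : Finset X, (F.card : ℝ) ≤ C * ε ^ (-s) ∧ ∀ x ∈ E, ∃ y ∈ F, dist x y ≤ ε / K := by
  obtain ⟨C, hC, hF⟩ := h
  have hK0 : 0 < K := by linarith
  refine ⟨C * K ^ s, by positivity, fun ε h1 h2 => ?_⟩
  obtain ⟨F, hFc, hcov⟩ := hF (ε / K) (by positivity) (by rw [div_lt_one hK0]; linarith)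
  refine ⟨F, ?_, hcov⟩
  rw [Real.div_rpow h1.le hK0.le, Real.rpow_neg hK0.le, div_inv_eq_mul] at hFc
  linarith

lemma BoxBound.image {E : Set X} {s : ℝ} (h : BoxBound E s) {f : X → Y} {K : ℝ}
    (hf : ∀ x y, dist (f x) (f y) ≤ K * dist x y) : BoxBound (f '' E) s := by
  classical
  have hK : 1 ≤ max K 1 := le_max_right _ _
  obtain ⟨C, hC, hF⟩ := h.exists_scaled hK
  refine ⟨C, hC, fun ε h1 h2 => ?_⟩
  obtain ⟨F, hFc, hcov⟩ := hF ε h1 h2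
  refine ⟨F.image f, le_trans (by exact_mod_cast Finset.card_image_le) hFc, ?_⟩
  rintro _ ⟨x, hx, rfl⟩
  obtain ⟨y, hy, hxy⟩ := hcov x hx
  refine ⟨f y, Finset.mem_image_of_mem f hy, ?_⟩
  rw [le_div_iff₀ (by linarith)] at hxy
  have := hf x y
  have h3 : K * dist x y ≤ max K 1 * dist x y :=
    mul_le_mul_of_nonneg_right (le_max_left _ _) dist_nonneg
  linarith

end BoxBound

lemma BoxBound.mul_image {A : Set ℝ} {s : ℝ} (h : BoxBound A s) (c : ℝ) :
    BoxBound ((fun x => c * x) '' A) s :=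
  h.image (K := |c|) fun x y => by rw [Real.dist_eq, Real.dist_eq, ← mul_sub, abs_mul]

lemma BoxBound.add_image {A : Set ℝ} {s : ℝ} (h : BoxBound A s) (c : ℝ) :
    BoxBound ((fun x => x + c) '' A) s :=
  h.image (K := 1) fun x y => by simp

/-- Adding all copies of `A` scaled by powers of `l` increases the exponent by an arbitrarily
small amount. -/
lemma BoxBound.iUnion_pow_mul {A : Set ℝ} {s s' l : ℝ} (h : BoxBound A s) (hs : 0 ≤ s)
    (hss : s < s') (hl : 0 < l) (hl1 : l < 1) :
    BoxBound (⋃ k : ℕ, (fun x => l ^ k * x) '' A) s' := by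
  classical
  obtain ⟨R, hR⟩ := h.isBounded.exists_norm_le
  obtain ⟨C, hC, hF⟩ := h
  set η := s' - s with hη
  have hη0 : 0 < η := by linarith
  set Λ := -Real.log l with hΛ
  have hΛ0 : 0 < Λ := by have := Real.log_neg hl hl1; linarith
  set M := max R 1 with hM
  have hM1 : 1 ≤ M := le_max_right _ _
  have hlogM : 0 ≤ Real.log M := Real.log_nonneg hM1
  refine ⟨(Real.log M / Λ + 1 / (η * Λ) + 2) * C + 1, by positivity, fun ε h1 h2 => ?_⟩
  obtain ⟨F, hFc, hcov⟩ := hF ε h1 h2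
  -- From index `K` on, `l ^ k * M ≤ ε`, so the single centre `0` covers all those copies. The
  -- remaining `K = O(log (1 / ε))` copies are covered separately, and the logarithm is absorbed by
  -- `ε ^ (-η)`.
  set K := ⌈Real.log (M / ε) / Λ⌉₊ with hK
  refine ⟨insert 0 ((Finset.range K).biUnion fun k => F.image fun x => l ^ k * x), ?_, ?_⟩
  · have hc1 : (insert 0 ((Finset.range K).biUnion fun k => F.image fun x => l ^ k * x)).card
        ≤ K * F.card + 1 := by
      refine (Finset.card_insert_le _ _).trans (Nat.add_le_add_right ?_ 1)
      refine Finset.card_biUnion_le.trans ?_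
      refine (Finset.sum_le_sum fun k _ => Finset.card_image_le).trans ?_
      simp
    have hc2 : ((insert 0 ((Finset.range K).biUnion fun k => F.image fun x => l ^ k * x)).card : ℝ)
        ≤ K * F.card + 1 := by exact_mod_cast hc1
    have hp : 0 < ε ^ (-s) := Real.rpow_pos_of_pos h1 _
    have hq1 : 1 ≤ ε ^ (-η) :=
      Real.one_le_rpow_of_pos_of_le_one_of_nonpos h1 h2.le (by linarith)
    have hp1 : 1 ≤ ε ^ (-s) :=
      Real.one_le_rpow_of_pos_of_le_one_of_nonpos h1 h2.le (by linarith)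
    have hlogε : Real.log (1 / ε) ≤ ε ^ (-η) / η := by
      have := Real.log_le_rpow_div (x := 1 / ε) (by positivity) hη0
      rwa [one_div, Real.inv_rpow h1.le, ← Real.rpow_neg h1.le, ← one_div] at this
    have hlogpos : 0 ≤ Real.log (1 / ε) := Real.log_nonneg (by rw [le_div_iff₀ h1]; linarith)
    have hsplit : Real.log (M / ε) = Real.log M + Real.log (1 / ε) := by
      rw [← Real.log_mul (by linarith) (by positivity)]; congr 1; ring
    have hKle : (K : ℝ) ≤ Real.log (M / ε) / Λ + 1 :=
      (Nat.ceil_lt_add_one (by rw [hsplit]; positivity)).le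
    have hKle2 : (K : ℝ) ≤ (Real.log M / Λ + 1 / (η * Λ) + 1) * ε ^ (-η) := by
      refine hKle.trans ?_
      rw [hsplit, add_div]
      have e1 : Real.log (1 / ε) / Λ ≤ 1 / (η * Λ) * ε ^ (-η) := by
        rw [div_le_iff₀ hΛ0]
        refine hlogε.trans (le_of_eq ?_)
        field_simp
      have e2 : Real.log M / Λ ≤ Real.log M / Λ * ε ^ (-η) :=
        le_mul_of_one_le_right (by positivity) hq1
      linarith
    have hsum : ε ^ (-s') = ε ^ (-η) * ε ^ (-s) := by
      rw [← Real.rpow_add h1]; congr 1; rw [hη]; ring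
    refine hc2.trans ?_
    have hKF : (K : ℝ) * F.card ≤
        ((Real.log M / Λ + 1 / (η * Λ) + 1) * ε ^ (-η)) * (C * ε ^ (-s)) :=
      mul_le_mul hKle2 hFc (by positivity) (by positivity)
    rw [hsum]
    have hpq : 1 ≤ ε ^ (-η) * ε ^ (-s) := by nlinarith
    have : 0 ≤ C * (ε ^ (-η) * ε ^ (-s)) := by positivity
    nlinarith
  · intro x hx
    obtain ⟨k, hk⟩ := Set.mem_iUnion.1 hx
    obtain ⟨a, ha, rfl⟩ := hk
    have hlk : l ^ k ≤ 1 := pow_le_one₀ hl.le hl1.le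
    have hlk0 : 0 < l ^ k := pow_pos hl k
    rcases lt_or_ge k K with hkK | hkK
    · obtain ⟨y, hy, hxy⟩ := hcov a ha
      refine ⟨l ^ k * y, Finset.mem_insert_of_mem (Finset.mem_biUnion.2
        ⟨k, Finset.mem_range.2 hkK, Finset.mem_image_of_mem _ hy⟩), ?_⟩
      simp only [Real.dist_eq] at hxy ⊢
      rw [← mul_sub, abs_mul, abs_of_pos hlk0]
      nlinarith [abs_nonneg (a - y)]
    · refine ⟨0, Finset.mem_insert_self _ _, ?_⟩
      simp only [Real.dist_eq, sub_zero]
      rw [abs_mul, abs_of_pos hlk0]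
      have ha' : |a| ≤ M := (hR a ha).trans (le_max_left _ _)
      have hk2 : Real.log (M / ε) / Λ ≤ k := (Nat.le_ceil _).trans (by exact_mod_cast hkK)
      rw [div_le_iff₀ hΛ0] at hk2
      have hle : M / ε ≤ (l ^ k)⁻¹ := by
        rw [← Real.log_le_log_iff (by positivity) (by positivity), Real.log_inv, Real.log_pow]
        linarith
      rw [div_le_iff₀ h1, inv_mul_eq_div, le_div_iff₀ hlk0] at hle
      nlinarith

/-! ### Progressions with prescribed differences -/

lemma ContainsAP.mono {R : Type*} [Semiring R] {k : ℕ} {d : R} {A A' : Set R}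
    (h : ContainsAP k d A) (hA : A ⊆ A') : ContainsAP k d A' :=
  let ⟨a, ha⟩ := h
  ⟨a, fun i hi => hA (ha i hi)⟩

lemma ContainsAP.mul_image {k : ℕ} {d : ℝ} {A : Set ℝ} (h : ContainsAP k d A) (c : ℝ) :
    ContainsAP k (c * d) ((fun x => c * x) '' A) := by
  obtain ⟨a, ha⟩ := h
  exact ⟨c * a, fun i hi => ⟨a + i * d, ha i hi, by ring⟩⟩

/-- The set of differences of progressions in a compact set is closed. -/
lemma containsAP_closure {m : ℕ} (hm : 0 < m) {A T : Set ℝ} (hA : Bornology.IsBounded A)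
    (h : ∀ t ∈ T, ContainsAP m t A) {t : ℝ} (ht : t ∈ closure T) :
    ContainsAP m t (closure A) := by
  obtain ⟨x, hxT, hx⟩ := mem_closure_iff_seq_limit.1 ht
  choose a ha using fun k => h (x k) (hxT k)
  have ha0 : ∀ k, a k ∈ closure A := fun k => subset_closure (by simpa using ha k 0 hm)
  obtain ⟨b, -, φ, hφ, hb⟩ := hA.isCompact_closure.tendsto_subseq ha0
  refine ⟨b, fun i hi => ?_⟩
  refine isClosed_closure.mem_of_tendsto (hb.add ((hx.comp hφ.tendsto_atTop).const_mul (i : ℝ)))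
    (Eventually.of_forall fun k => subset_closure (ha (φ k) i hi))

/-- If the differences of the progressions in `A` fill an interval away from zero, then rescaled
copies of `A` form a set with progressions of all differences in `[0, 1]`. -/
lemma exists_isAPSet_of_Icc {m : ℕ} {A : Set ℝ} {s s' α β : ℝ}
    (hA : BoxBound A s) (hne : A.Nonempty) (hss : s < s') (hα : 0 < α) (hαβ : α < β)
    (h : ∀ t ∈ Set.Icc α β, ContainsAP m t A) :
    ∃ A' : Set ℝ, IsAPSet m A' ∧ BoxBound A' s' := by
  have hs : 0 ≤ s := hA.nonneg hne
  have hβ : 0 < β := hα.trans hαβ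
  set l := α / β with hl
  have hl0 : 0 < l := by positivity
  have hl1 : l < 1 := by rw [hl, div_lt_one hβ]; exact hαβ
  set A₁ := (fun x => β⁻¹ * x) '' A with hA₁
  have h₁ : ∀ t ∈ Set.Icc l 1, ContainsAP m t A₁ := by
    intro t ht
    have h2 := (h (β * t) ⟨?_, ?_⟩).mul_image β⁻¹
    · rwa [← mul_assoc, inv_mul_cancel₀ hβ.ne', one_mul] at h2
    · have := mul_le_mul_of_nonneg_left ht.1 hβ.le
      rwa [hl, mul_div_cancel₀ _ hβ.ne'] at this
    · nlinarith [ht.2]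
  obtain ⟨a₀, ha₀⟩ := hne.image (fun x => β⁻¹ * x)
  refine ⟨⋃ k : ℕ, (fun x => l ^ k * x) '' A₁, ?_, (hA.mul_image β⁻¹).iUnion_pow_mul hs hss hl0 hl1⟩
  intro t ht
  rcases ht.1.eq_or_lt with rfl | ht0
  · exact ⟨a₀, fun i _ => Set.mem_iUnion.2 ⟨0, a₀, ha₀, by simp⟩⟩
  -- The intervals `[l ^ (k + 1), l ^ k]` tile `(0, 1]`, so the `k`-th copy handles the differences
  -- in the `k`-th interval.
  · obtain ⟨k, hk1, hk2⟩ := exists_nat_pow_near_of_lt_one ht0 ht.2 hl0 hl1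
    have hlk : 0 < l ^ k := pow_pos hl0 k
    have h3 := (h₁ (t / l ^ k) ⟨?_, ?_⟩).mul_image (l ^ k)
    · rw [mul_div_cancel₀ _ hlk.ne'] at h3
      exact h3.mono (Set.subset_iUnion (fun k : ℕ => (fun x => l ^ k * x) '' A₁) k)
    · rw [le_div_iff₀ hlk, ← pow_succ']; exact hk1.le
    · rw [div_le_one hlk]; exact hk2

/-- Rescaling needs positive differences bounded away from zero, but the open set may be negative;
the sign `c = ±1` reflects it if necessary. -/
lemma exists_Icc_subset_of_isOpen {U : Set ℝ} (hU : IsOpen U) (hne : U.Nonempty) :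
    ∃ c α β : ℝ, 0 < α ∧ α < β ∧ ∀ t ∈ Set.Icc α β, c * t ∈ U ∧ c * c = 1 := by
  obtain ⟨x, hx, hx0⟩ : ∃ x ∈ U, x ≠ 0 :=
    ((dense_compl_singleton (0 : ℝ)).inter_open_nonempty U hU hne)
  obtain ⟨c, hc, hcx⟩ : ∃ c : ℝ, c * c = 1 ∧ 0 < c * x := by
    rcases hx0.lt_or_gt with h | h
    · exact ⟨-1, by norm_num, by linarith⟩
    · exact ⟨1, by norm_num, by linarith⟩
  have hV : IsOpen ((fun t => c * t) ⁻¹' U) := hU.preimage (by fun_prop)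
  have hmem : c * x ∈ (fun t => c * t) ⁻¹' U := by
    simp only [Set.mem_preimage, ← mul_assoc, hc, one_mul]; exact hx
  obtain ⟨δ, hδ, hball⟩ := Metric.isOpen_iff.1 hV _ hmem
  refine ⟨c, c * x, c * x + δ / 2, hcx, by linarith, fun t ht => ⟨hball ?_, hc⟩⟩
  rw [Metric.mem_ball, Real.dist_eq, abs_lt]
  constructor <;> linarith [ht.1, ht.2]

/-- If `A` contains progressions with a somewhere dense set of differences, then its box exponent
bounds `fM`. -/
lemma fM_le_of_somewhere_dense {m : ℕ} {A T : Set ℝ} {s : ℝ} (hs : 0 ≤ s) (hA : BoxBound A s)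
    (hT : (interior (closure T)).Nonempty) (h : ∀ t ∈ T, ContainsAP m t A) : fM m ≤ s := by
  rcases Nat.eq_zero_or_pos m with rfl | hm
  · have h0 : IsAPSet 0 ∅ := fun t _ => ⟨0, fun i hi => absurd hi (Nat.not_lt_zero i)⟩
    exact (iInf₂_le _ h0).trans (by rw [dimM_empty]; exact_mod_cast hs)
  obtain ⟨c, α, β, hα, hαβ, hI⟩ := exists_Icc_subset_of_isOpen isOpen_interior hT
  have hc : c * c = 1 := (hI α ⟨le_rfl, hαβ.le⟩).2
  have hcl : ∀ t ∈ Set.Icc α β, ContainsAP m t ((fun x => c * x) '' closure A) := by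
    intro t ht
    have := (containsAP_closure hm hA.isBounded h (interior_subset (hI t ht).1)).mul_image c
    rwa [← mul_assoc, hc, one_mul] at this
  have hne : ((fun x => c * x) '' closure A).Nonempty := by
    obtain ⟨a, ha⟩ := hcl α ⟨le_rfl, hαβ.le⟩
    exact ⟨_, ha 0 hm⟩
  refine EReal.le_of_forall_lt_iff_le.1 fun z hz => ?_
  have hz' : s < z := by exact_mod_cast hz
  obtain ⟨A', hA', hb⟩ := exists_isAPSet_of_Icc (hA.closure.mul_image c) hne hz' hα hαβ hcl
  exact (iInf₂_le _ hA').trans (hb.dimM_le (by linarith))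

/-! ### Baire category and packing dimension -/

lemma exists_interior_closure_nonempty {X ι : Type*} [TopologicalSpace X] [BaireSpace X]
    [Countable ι] {U : Set X} (hU : IsOpen U) (hne : U.Nonempty) {S : ι → Set X}
    (h : U ⊆ ⋃ i, S i) : ∃ i, (interior (closure (S i))).Nonempty := by
  by_contra! hcon
  refine not_isMeagre_of_isOpen hU hne (IsMeagre.mono h (isMeagre_iUnion fun i => ?_))
  exact IsNowhereDense.isMeagre (hcon i)

lemma fP_le_fM (m : ℕ) : fP m ≤ fM m :=
  iInf₂_mono fun A _ => dimP_le_dimM A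

/-- A progression has finitely many terms, so it lies in a finite union of pieces of the
decomposition. There are countably many such initial unions, hence by Baire one of them serves a
somewhere dense set of differences, and it still has the same box exponent. -/
lemma fM_le_fP (m : ℕ) : fM m ≤ fP m := by
  refine le_iInf₂ fun A hA => le_iInf₂ fun S hS => ?_
  refine EReal.le_of_forall_lt_iff_le.1 fun z hz => ?_
  have hb : ∀ j, BoxBound (S j) z := fun j =>
    boxBound_of_dimM_lt ((le_iSup (fun j => dimM (S j)) j).trans_lt hz)
  have hz0 : 0 ≤ z := by
    have : (0 : EReal) < z := (dimM_nonneg (S 0)).trans_lt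
      ((le_iSup (fun j => dimM (S j)) 0).trans_lt hz)
    exact_mod_cast this.le
  set A' : ℕ → Set ℝ := fun k => ⋃ i ∈ Finset.range (k + 1), S i with hA'
  have hcov : Set.Ioo (0 : ℝ) 1 ⊆ ⋃ k, {t | ContainsAP m t (A' k)} := by
    intro t ht
    obtain ⟨a, ha⟩ := hA t ⟨ht.1.le, ht.2.le⟩
    have : ∀ i : ℕ, ∃ j, i < m → a + i * t ∈ S j := fun i => by
      by_cases hi : i < m
      · obtain ⟨j, hj⟩ := Set.mem_iUnion.1 (hS (ha i hi))
        exact ⟨j, fun _ => hj⟩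
      · exact ⟨0, fun h => absurd h hi⟩
    choose j hj using this
    refine Set.mem_iUnion.2 ⟨(Finset.range m).sup j, a, fun i hi => ?_⟩
    refine Set.mem_biUnion (x := j i) ?_ (hj i hi)
    have := Finset.le_sup (f := j) (Finset.mem_range.2 hi)
    simp only [Finset.coe_range, Set.mem_Iio]
    omega
  obtain ⟨k, hk⟩ := exists_interior_closure_nonempty isOpen_Ioo
    ⟨1 / 2, by norm_num, by norm_num⟩ hcov
  exact fM_le_of_somewhere_dense hz0 (BoxBound.biUnion _ fun i _ => hb i) hk fun t ht => ht

lemma fM_eq_fP (m : ℕ) : fM m = fP m :=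
  le_antisymm (fM_le_fP m) (fP_le_fM m)

lemma fM_nonneg (m : ℕ) : 0 ≤ fM m :=
  le_iInf₂ fun A _ => dimM_nonneg A

/-! ### Covering numbers of slices by parallel hyperplanes -/

/-- A unit vector extends to an orthonormal frame. -/
lemma exists_orthonormal_frame {n : ℕ} {u : EuclideanSpace ℝ (Fin n)} (hu : ‖u‖ = 1) :
    ∃ w : Fin (n - 1) → EuclideanSpace ℝ (Fin n), (∀ i, inner ℝ u (w i) = 0) ∧
      Orthonormal ℝ w ∧ ∀ y, y = inner ℝ u y • u + ∑ i, inner ℝ (w i) y • w i := by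
  have hu0 : u ≠ 0 := by rintro rfl; simp at hu
  have hn : 0 < n := by
    rcases Nat.eq_zero_or_pos n with rfl | h
    · exact absurd (Subsingleton.elim u 0) hu0
    · exact h
  have hfact : Fact (Module.finrank ℝ (EuclideanSpace ℝ (Fin n)) = (n - 1) + 1) :=
    ⟨by simp; omega⟩
  have hrank : Module.finrank ℝ (ℝ ∙ u)ᗮ = n - 1 :=
    Submodule.finrank_orthogonal_span_singleton hu0
  set b := (stdOrthonormalBasis ℝ (ℝ ∙ u)ᗮ).reindex (finCongr hrank) with hb
  refine ⟨fun i => (b i : EuclideanSpace ℝ (Fin n)), fun i => ?_, ?_, fun y => ?_⟩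
  · exact Submodule.mem_orthogonal_singleton_iff_inner_right.1 (b i).2
  · exact b.orthonormal.comp_linearIsometry (ℝ ∙ u)ᗮ.subtypeₗᵢ
  · have hz : y - inner ℝ u y • u ∈ (ℝ ∙ u)ᗮ := by
      rw [Submodule.mem_orthogonal_singleton_iff_inner_right, inner_sub_right, inner_smul_right,
        real_inner_self_eq_norm_sq, hu]
      ring
    have hsum := congrArg (Subtype.val) (b.sum_repr' ⟨_, hz⟩)
    simp only [Submodule.coe_inner, Submodule.coe_sum, Submodule.coe_smul] at hsum
    have hi : ∀ i, inner ℝ (b i : EuclideanSpace ℝ (Fin n)) (y - inner ℝ u y • u) =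
        inner ℝ (b i : EuclideanSpace ℝ (Fin n)) y := fun i => by
      rw [inner_sub_right, inner_smul_right, real_inner_comm u,
        Submodule.mem_orthogonal_singleton_iff_inner_right.1 (b i).2]
      ring
    simp only [hi] at hsum
    rw [hsum]
    abel

lemma boxBound_Icc (R : ℝ) : BoxBound (Set.Icc (-R) R) 1 := by
  classical
  rcases lt_or_ge R 0 with hR | hR
  · rw [Set.Icc_eq_empty (by linarith)]; exact boxBound_empty 1
  refine ⟨2 * R + 1, by linarith, fun ε h1 h2 => ?_⟩
  refine ⟨(Finset.range (⌊2 * R / ε⌋₊ + 1)).image fun k : ℕ => -R + k * ε, ?_, ?_⟩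
  · have hc : (((Finset.range (⌊2 * R / ε⌋₊ + 1)).image fun k : ℕ => -R + k * ε).card : ℝ) ≤
        ⌊2 * R / ε⌋₊ + 1 := by
      exact_mod_cast Finset.card_image_le.trans (by simp)
    have hfl := Nat.floor_le (show 0 ≤ 2 * R / ε by positivity)
    rw [Real.rpow_neg_one, ← div_eq_mul_inv]
    have : (1 : ℝ) ≤ 1 / ε := by rw [le_div_iff₀ h1]; linarith
    rw [add_div]
    linarith
  · intro x hx
    have hx0 : 0 ≤ (x + R) / ε := div_nonneg (by linarith [hx.1]) h1.le
    refine ⟨-R + ⌊(x + R) / ε⌋₊ * ε, Finset.mem_image.2 ⟨_, Finset.mem_range.2 ?_, rfl⟩, ?_⟩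
    · exact Nat.lt_succ_of_le (Nat.floor_mono (div_le_div_of_nonneg_right (by linarith [hx.2]) h1.le))
    · have e1 := Nat.floor_le hx0
      have e2 := (Nat.lt_floor_add_one ((x + R) / ε)).le
      rw [le_div_iff₀ h1] at e1
      rw [div_le_iff₀ h1] at e2
      rw [Real.dist_eq, abs_le]
      constructor <;> linarith

/-- A bounded union of slices `⟨u, y⟩ = v`, `v ∈ S`, has box exponent `n - 1` more than `S`. -/
lemma BoxBound.slab {n : ℕ} {u : EuclideanSpace ℝ (Fin n)} (hu : ‖u‖ = 1) {S : Set ℝ} {s : ℝ}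
    (hS : BoxBound S s) (R : ℝ) :
    BoxBound {y : EuclideanSpace ℝ (Fin n) | ‖y‖ ≤ R ∧ inner ℝ u y ∈ S} (s + ((n : ℝ) - 1)) := by
  classical
  have hn : 1 ≤ n := by
    rcases Nat.eq_zero_or_pos n with rfl | h
    · rw [Subsingleton.elim u 0] at hu; simp at hu
    · exact h
  have hn' : (1 : ℝ) ≤ n := by exact_mod_cast hn
  obtain ⟨w, hw0, hwo, hwexp⟩ := exists_orthonormal_frame hu
  -- Radius `ε / n` in each of the `n` orthonormal coordinates, so that the errors sum to `ε`.
  obtain ⟨C, hC, hF⟩ := hS.exists_scaled hn'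
  obtain ⟨D, hD, hG⟩ := (boxBound_Icc R).exists_scaled hn'
  refine ⟨C * D ^ (n - 1), by positivity, fun ε h1 h2 => ?_⟩
  obtain ⟨F, hFc, hFcov⟩ := hF ε h1 h2
  obtain ⟨G, hGc, hGcov⟩ := hG ε h1 h2
  refine ⟨(F ×ˢ Fintype.piFinset fun _ : Fin (n - 1) => G).image
    fun q => q.1 • u + ∑ i, q.2 i • w i, ?_, ?_⟩
  · have hc : (((F ×ˢ Fintype.piFinset fun _ : Fin (n - 1) => G).image
        fun q => q.1 • u + ∑ i, q.2 i • w i).card : ℝ) ≤ F.card * (G.card : ℝ) ^ (n - 1) := by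
      refine le_trans (Nat.cast_le.2 Finset.card_image_le) (le_of_eq ?_)
      rw [Finset.card_product, Fintype.card_piFinset]
      simp
    refine hc.trans ?_
    have hpow : ε ^ (-(s + ((n : ℝ) - 1))) = ε ^ (-s) * (ε ^ (-1 : ℝ)) ^ (n - 1) := by
      rw [← Real.rpow_natCast, ← Real.rpow_mul h1.le, ← Real.rpow_add h1, Nat.cast_sub hn]
      congr 1; push_cast; ring
    calc F.card * (G.card : ℝ) ^ (n - 1)
        ≤ (C * ε ^ (-s)) * (D * ε ^ (-1 : ℝ)) ^ (n - 1) :=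
          mul_le_mul hFc (pow_le_pow_left₀ (Nat.cast_nonneg _) hGc _)
            (pow_nonneg (Nat.cast_nonneg _) _) (by positivity)
      _ = _ := by rw [hpow, mul_pow]; ring
  · rintro y ⟨hyR, hyS⟩
    obtain ⟨a, ha, hda⟩ := hFcov _ hyS
    have hcoord : ∀ i, inner ℝ (w i) y ∈ Set.Icc (-R) R := fun i => by
      have := abs_real_inner_le_norm (w i) y
      rw [hwo.1 i, one_mul] at this
      exact abs_le.1 (this.trans hyR)
    choose g hg hdg using fun i => hGcov _ (hcoord i)
    refine ⟨a • u + ∑ i, g i • w i, Finset.mem_image.2 ⟨(a, g), ?_, rfl⟩, ?_⟩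
    · exact Finset.mem_product.2 ⟨ha, Fintype.mem_piFinset.2 hg⟩
    · rw [dist_eq_norm]
      have heq : y - (a • u + ∑ i, g i • w i) =
          (inner ℝ u y - a) • u + ∑ i, (inner ℝ (w i) y - g i) • w i := by
        simp only [sub_smul, Finset.sum_sub_distrib]
        nth_rewrite 1 [hwexp y]
        abel
      rw [heq]
      calc _ ≤ ‖(inner ℝ u y - a) • u‖ + ∑ i, ‖(inner ℝ (w i) y - g i) • w i‖ :=
            (norm_add_le _ _).trans (add_le_add_right (norm_sum_le _ _) _)
        _ ≤ ε / n + ∑ _i : Fin (n - 1), ε / n := by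
            refine add_le_add ?_ (Finset.sum_le_sum fun i _ => ?_)
            · rw [norm_smul, hu, mul_one]; exact hda
            · rw [norm_smul, hwo.1 i, mul_one]; exact hdg i
        _ = ε := by
            rw [Finset.sum_const, Finset.card_univ, Fintype.card_fin, nsmul_eq_mul,
              Nat.cast_sub hn]
            field_simp
            push_cast
            ring

lemma boxBound_closedBall {n : ℕ} (hn : 1 ≤ n) (R : ℝ) :
    BoxBound (Metric.closedBall (0 : EuclideanSpace ℝ (Fin n)) R) n := by
  have hu : ‖EuclideanSpace.single (⟨0, hn⟩ : Fin n) (1 : ℝ)‖ = 1 := by simp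
  refine ((boxBound_Icc R).slab hu R).mono (fun y hy => ?_) (by linarith)
  have hy' : ‖y‖ ≤ R := by simpa using hy
  refine ⟨hy', abs_le.1 ?_⟩
  have := abs_real_inner_le_norm (EuclideanSpace.single (⟨0, hn⟩ : Fin n) (1 : ℝ)) y
  rw [hu, one_mul] at this
  exact this.trans hy'

/-- A set of reals has an `ε`-net whose size is at most any bound for `ε`-separated sets. -/
lemma exists_net_of_separated_bound {V : Set ℝ} {ε b : ℝ} (hε : 0 ≤ ε)
    (h : ∀ Q : Finset ℝ, (Q : Set ℝ) ⊆ V → (∀ x ∈ Q, ∀ y ∈ Q, x ≠ y → ε < dist x y) →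
      (Q.card : ℝ) ≤ b) :
    ∃ Q : Finset ℝ, (Q.card : ℝ) ≤ b ∧ ∀ x ∈ V, ∃ y ∈ Q, dist x y ≤ ε := by
  classical
  -- A separated set of maximal size is a net, since a point farther than `ε` from it could be
  -- added.
  set N : Set ℕ := {k | ∃ Q : Finset ℝ, (Q : Set ℝ) ⊆ V ∧
    (∀ x ∈ Q, ∀ y ∈ Q, x ≠ y → ε < dist x y) ∧ Q.card = k} with hN
  have hne : N.Nonempty := ⟨0, ∅, by simp, by simp, by simp⟩
  have hbd : BddAbove N := by
    refine ⟨⌊b⌋₊, ?_⟩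
    rintro k ⟨Q, hQ, hs, rfl⟩
    exact Nat.le_floor (h Q hQ hs)
  obtain ⟨Q, hQ, hs, hcard⟩ := Nat.sSup_mem hne hbd
  refine ⟨Q, h Q hQ hs, fun x hx => ?_⟩
  by_contra! hcon
  have hxQ : x ∉ Q := fun hxQ => by
    have := hcon x hxQ
    rw [dist_self] at this
    linarith
  have hmem : Q.card + 1 ∈ N := by
    refine ⟨insert x Q, ?_, ?_, Finset.card_insert_of_notMem hxQ⟩
    · rw [Finset.coe_insert]; exact Set.insert_subset hx hQ
    · intro a ha c hc hac
      rcases Finset.mem_insert.1 ha with rfl | ha'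
      · rcases Finset.mem_insert.1 hc with rfl | hc'
        · exact absurd rfl hac
        · exact hcon c hc'
      · rcases Finset.mem_insert.1 hc with rfl | hc'
        · rw [dist_comm]; exact hcon a ha'
        · exact hs a ha' c hc' hac
  have := le_csSup hbd hmem
  omega

/-- If `B` contains a disc of fixed radius in the slice `⟨u, y⟩ = v` for each `v ∈ V`, then the box
exponent of `V` is at least `n - 1` less than that of `B`. -/
lemma BoxBound.of_discs {n : ℕ} {u : EuclideanSpace ℝ (Fin n)} (hu : ‖u‖ = 1)
    {B : Set (EuclideanSpace ℝ (Fin n))} {s ρ : ℝ} (hB : BoxBound B s) (hρ : 0 < ρ) {V : Set ℝ}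
    (hV : ∀ v ∈ V, ∃ p, inner ℝ u p = v ∧ ∀ w, inner ℝ u w = 0 → ‖w‖ < ρ → p + w ∈ B) :
    BoxBound V (s - ((n : ℝ) - 1)) := by
  classical
  have hn : 1 ≤ n := by
    rcases Nat.eq_zero_or_pos n with rfl | h
    · rw [Subsingleton.elim u 0] at hu; simp at hu
    · exact h
  have hn' : (1 : ℝ) ≤ n := by exact_mod_cast hn
  obtain ⟨w, hw0, hwo, -⟩ := exists_orthonormal_frame hu
  -- With radius `ε / 3`, two points sharing a centre are at distance at most `2 * ε / 3 < ε`, so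
  -- `ε`-separated points need distinct centres.
  obtain ⟨C, hC, hF⟩ := hB.exists_scaled (K := 3) (by norm_num)
  refine ⟨C * (n / ρ) ^ (n - 1), by positivity, fun ε h1 h2 => ?_⟩
  obtain ⟨F, hFc, hcov⟩ := hF ε h1 h2
  refine exists_net_of_separated_bound h1.le fun Q hQV hsep => ?_
  -- Each disc receives a grid of spacing `ε` with `L` points per direction. The ceiling ensures `(L
  -- - 1) * (n * ε) < ρ`, which keeps the grid inside the disc.
  set L := ⌈ρ / (n * ε)⌉₊ with hL
  have hLge : ρ / (n * ε) ≤ L := Nat.le_ceil _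
  have hpos : 0 < ρ / (n * ε) := by positivity
  have hL0 : 0 < L := Nat.ceil_pos.2 hpos
  have hLlt : (L : ℝ) < ρ / (n * ε) + 1 := Nat.ceil_lt_add_one hpos.le
  choose! p hp hpB using hV
  set pt : ℝ × (Fin (n - 1) → ℕ) → EuclideanSpace ℝ (Fin n) :=
    fun q => p q.1 + ∑ i, ((q.2 i : ℝ) * ε) • w i with hpt
  set D := Q ×ˢ Fintype.piFinset fun _ : Fin (n - 1) => Finset.range L with hD
  have hsum0 : ∀ k : Fin (n - 1) → ℕ, inner ℝ u (∑ i, ((k i : ℝ) * ε) • w i) = 0 := fun k => by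
    rw [inner_sum]
    exact Finset.sum_eq_zero fun i _ => by rw [inner_smul_right, hw0, mul_zero]
  have hptB : ∀ q ∈ D, pt q ∈ B := by
    rintro ⟨v, k⟩ hq
    obtain ⟨hv, hk⟩ := Finset.mem_product.1 hq
    refine hpB v (hQV hv) _ (hsum0 k) ?_
    have hle : ‖∑ i, ((k i : ℝ) * ε) • w i‖ ≤ ((n : ℝ) - 1) * ((L - 1) * ε) := by
      refine (norm_sum_le _ _).trans ?_
      calc ∑ i, ‖((k i : ℝ) * ε) • w i‖ ≤ ∑ _i : Fin (n - 1), (L - 1) * ε := by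
            refine Finset.sum_le_sum fun i _ => ?_
            have hki : k i + 1 ≤ L := Finset.mem_range.1 (Fintype.mem_piFinset.1 hk i)
            have hki' : (k i : ℝ) + 1 ≤ L := by exact_mod_cast hki
            rw [norm_smul, hwo.1 i, mul_one, Real.norm_of_nonneg (by positivity)]
            exact mul_le_mul_of_nonneg_right (by linarith) h1.le
        _ = _ := by
            rw [Finset.sum_const, Finset.card_univ, Fintype.card_fin, nsmul_eq_mul,
              Nat.cast_sub hn, Nat.cast_one]
    refine hle.trans_lt ?_
    have h3 : ((L : ℝ) - 1) * (n * ε) < ρ := by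
      rw [← lt_div_iff₀ (by positivity)]; linarith
    have h4 : 0 ≤ ((L : ℝ) - 1) * ε := mul_nonneg (by
      have : (1 : ℝ) ≤ L := by exact_mod_cast hL0
      linarith) h1.le
    nlinarith
  choose! c hcF hcd using hcov
  have hinj : Set.InjOn (fun q => c (pt q)) (D : Set (ℝ × (Fin (n - 1) → ℕ))) := by
    rintro ⟨v, k⟩ hq ⟨v', k'⟩ hq' heq
    have hd : ‖pt (v, k) - pt (v', k')‖ < ε := by
      rw [← dist_eq_norm]
      have e1 := hcd _ (hptB _ hq)
      have e2 := hcd _ (hptB _ hq')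
      simp only at heq
      rw [heq] at e1
      rw [dist_comm] at e2
      have := dist_triangle (pt (v, k)) (c (pt (v', k'))) (pt (v', k'))
      linarith
    obtain ⟨hv, hk⟩ := Finset.mem_product.1 hq
    obtain ⟨hv', hk'⟩ := Finset.mem_product.1 hq'
    have hvv : v = v' := by
      by_contra hne
      have h3 := hsep v hv v' hv' hne
      have h4 := abs_real_inner_le_norm u (pt (v, k) - pt (v', k'))
      rw [hu, one_mul, inner_sub_right] at h4
      simp only [hpt, inner_add_right, hsum0, hp v (hQV hv), hp v' (hQV hv'), add_zero] at h4
      rw [Real.dist_eq] at h3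
      simp only [hpt] at hd
      linarith
    subst hvv
    refine Prod.ext rfl (funext fun i => ?_)
    have h4 := abs_real_inner_le_norm (w i) (pt (v, k) - pt (v, k'))
    have h5 : inner ℝ (w i) (pt (v, k) - pt (v, k')) = ((k i : ℝ) - k' i) * ε := by
      simp only [hpt, add_sub_add_left_eq_sub, inner_sub_right]
      rw [hwo.inner_right_fintype, hwo.inner_right_fintype]
      ring
    rw [hwo.1 i, one_mul, h5, abs_mul, abs_of_pos h1] at h4
    have h6 : |(k i : ℝ) - k' i| < 1 := by
      by_contra! hge
      nlinarith
    have h7 : |((k i : ℤ) - k' i : ℤ)| < 1 := by exact_mod_cast h6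
    rw [Int.abs_lt_one_iff] at h7
    show k i = k' i
    omega
  have hcard : D.card ≤ F.card :=
    Finset.card_le_card_of_injOn _ (fun q hq => hcF _ (hptB q hq)) hinj
  have hDc : D.card = Q.card * L ^ (n - 1) := by
    rw [hD, Finset.card_product, Fintype.card_piFinset]
    simp
  have hcard' : (Q.card : ℝ) * (L : ℝ) ^ (n - 1) ≤ C * ε ^ (-s) := by
    refine le_trans ?_ hFc
    rw [hDc] at hcard
    exact_mod_cast hcard
  have hpow : ε ^ (-(s - ((n : ℝ) - 1))) = ε ^ (-s) * ε ^ (n - 1) := by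
    rw [← Real.rpow_natCast, ← Real.rpow_add h1, Nat.cast_sub hn]
    congr 1; push_cast; ring
  have hmul : (Q.card : ℝ) * (ρ / (n * ε)) ^ (n - 1) ≤ C * ε ^ (-s) :=
    le_trans (by gcongr) hcard'
  rw [← le_div_iff₀ (by positivity)] at hmul
  refine hmul.trans (le_of_eq ?_)
  rw [hpow, div_eq_mul_inv, ← inv_pow, inv_div, mul_div_right_comm, mul_pow]
  ring

/-! ### Faces of polytopes -/

section Body

variable {n s : ℕ} {u : Fin s → EuclideanSpace ℝ (Fin n)} {d : Fin s → ℝ}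

lemma isClosed_body : IsClosed (body u d) := by
  have : body u d = ⋂ i, {y | inner ℝ (u i) y ≤ d i} := by ext; simp [body]
  rw [this]
  exact isClosed_iInter fun i => isClosed_le (by fun_prop) (by fun_prop)

lemma convex_body : Convex ℝ (body u d) := by
  intro x hx y hy a b ha hb hab i
  rw [inner_add_right, inner_smul_right, inner_smul_right]
  have h1 := mul_le_mul_of_nonneg_left (hx i) ha
  have h2 := mul_le_mul_of_nonneg_left (hy i) hb
  have h3 : d i = a * d i + b * d i := by rw [← add_mul, hab, one_mul]
  linarith

lemma mem_interior_body {y : EuclideanSpace ℝ (Fin n)} (h : ∀ i, inner ℝ (u i) y < d i) :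
    y ∈ interior (body u d) := by
  have ho : IsOpen (⋂ i, {y | inner ℝ (u i) y < d i}) :=
    isOpen_iInter_of_finite fun i => isOpen_lt (by fun_prop) (by fun_prop)
  refine interior_maximal (fun z hz i => ?_) ho (Set.mem_iInter.2 h)
  exact le_of_lt (Set.mem_iInter.1 hz i)

lemma mem_frontier_body {y : EuclideanSpace ℝ (Fin n)} (h : y ∈ frontier (body u d)) :
    y ∈ body u d ∧ ∃ i, inner ℝ (u i) y = d i := by
  have hy : y ∈ body u d := isClosed_body.frontier_subset h
  refine ⟨hy, ?_⟩
  by_contra! hcon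
  exact h.2 (mem_interior_body fun i => lt_of_le_of_ne (hy i) (hcon i))

lemma inner_lt_of_mem_interior_body {y : EuclideanSpace ℝ (Fin n)}
    (h : y ∈ interior (body u d)) {i : Fin s} (hu : ‖u i‖ = 1) : inner ℝ (u i) y < d i := by
  obtain ⟨ε, hε, hball⟩ := Metric.isOpen_iff.1 isOpen_interior y h
  have hmem : y + (ε / 2) • u i ∈ body u d := interior_subset (hball (by
    rw [Metric.mem_ball, dist_eq_norm, add_sub_cancel_left, norm_smul, hu,
      Real.norm_of_nonneg (by linarith)]
    linarith))
  have := hmem i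
  rw [inner_add_right, inner_smul_right, real_inner_self_eq_norm_sq, hu] at this
  linarith

lemma mem_frontier_body_of_eq {y : EuclideanSpace ℝ (Fin n)} (hy : y ∈ body u d) {i : Fin s}
    (hu : ‖u i‖ = 1) (h : inner ℝ (u i) y = d i) : y ∈ frontier (body u d) :=
  ⟨subset_closure hy, fun hint => (inner_lt_of_mem_interior_body hint hu).ne h⟩

lemma vectorSpan_inter_hyperplane_le (S : Set (EuclideanSpace ℝ (Fin n)))
    (v : EuclideanSpace ℝ (Fin n)) (c : ℝ) : vectorSpan ℝ (S ∩ hyperplane v c) ≤ (ℝ ∙ v)ᗮ := by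
  rw [vectorSpan_def, Submodule.span_le]
  rintro _ ⟨x, hx, y, hy, rfl⟩
  have hx' : inner ℝ v x = c := hx.2
  have hy' : inner ℝ v y = c := hy.2
  rw [SetLike.mem_coe, Submodule.mem_orthogonal_singleton_iff_inner_right]
  simp only [vsub_eq_sub, inner_sub_right, hx', hy', sub_self]

/-- Each facet of a polytope contains a disc of its hyperplane. -/
lemma IsPolytopeWith.exists_disc {P : Set (EuclideanSpace ℝ (Fin n))} (hn : 1 < n)
    (h : IsPolytopeWith u d P) (i : Fin s) :
    ∃ p, ∃ ρ > 0, inner ℝ (u i) p = d i ∧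
      ∀ w, inner ℝ (u i) w = 0 → ‖w‖ < ρ → p + w ∈ P := by
  set Φ := body u d ∩ hyperplane (u i) (d i) with hΦ
  have hu := h.norm_normal i
  have hu0 : u i ≠ 0 := by intro h0; rw [h0] at hu; simp at hu
  have hconv : Convex ℝ Φ := by
    refine convex_body.inter ?_
    intro x hx y hy a b _ _ hab
    have hx' : inner ℝ (u i) x = d i := hx
    have hy' : inner ℝ (u i) y = d i := hy
    show inner ℝ (u i) (a • x + b • y) = d i
    rw [inner_add_right, inner_smul_right, inner_smul_right, hx', hy', ← add_mul, hab, one_mul]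
  have hfin : Module.finrank ℝ (vectorSpan ℝ Φ) + 1 = n := h.facet i
  have hne : Φ.Nonempty := by
    by_contra hemp
    rw [Set.not_nonempty_iff_eq_empty] at hemp
    rw [hemp, vectorSpan_empty, finrank_bot] at hfin
    omega
  have hle : vectorSpan ℝ Φ ≤ (ℝ ∙ u i)ᗮ := vectorSpan_inter_hyperplane_le _ _ _
  have hfact : Fact (Module.finrank ℝ (EuclideanSpace ℝ (Fin n)) = (n - 1) + 1) :=
    ⟨by simp; omega⟩
  have hrank : Module.finrank ℝ (ℝ ∙ u i)ᗮ = n - 1 :=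
    Submodule.finrank_orthogonal_span_singleton hu0
  have heq : vectorSpan ℝ Φ = (ℝ ∙ u i)ᗮ :=
    Submodule.eq_of_le_of_finrank_eq hle (by rw [hrank]; omega)
  -- The directions of the facet fill `(ℝ ∙ u i)ᗮ`, so an intrinsic interior point is the centre of
  -- a full disc of the hyperplane.
  obtain ⟨p, hp⟩ := Set.Nonempty.intrinsicInterior hconv hne
  obtain ⟨p', hp', rfl⟩ := mem_intrinsicInterior.1 hp
  obtain ⟨ρ, hρ, hball⟩ := Metric.isOpen_iff.1 isOpen_interior p' hp'
  have hpΦ : (p' : EuclideanSpace ℝ (Fin n)) ∈ Φ :=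
    Set.mem_preimage.1 (interior_subset hp')
  refine ⟨p', ρ, hρ, hpΦ.2, fun w hw hwρ => ?_⟩
  have hwdir : w ∈ (affineSpan ℝ Φ).direction := by
    rw [direction_affineSpan, heq]
    exact Submodule.mem_orthogonal_singleton_iff_inner_right.2 hw
  have hmem : w +ᵥ (p' : EuclideanSpace ℝ (Fin n)) ∈ affineSpan ℝ Φ :=
    AffineSubspace.vadd_mem_of_mem_direction hwdir p'.2
  have hin : (⟨_, hmem⟩ : affineSpan ℝ Φ) ∈ Metric.ball p' ρ := by
    rw [Metric.mem_ball, Subtype.dist_eq]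
    show dist (w + (p' : EuclideanSpace ℝ (Fin n))) p' < ρ
    rwa [dist_eq_norm, add_sub_cancel_right]
  have hΦmem : w + (p' : EuclideanSpace ℝ (Fin n)) ∈ Φ :=
    (interior_subset (hball hin) : (⟨_, hmem⟩ : affineSpan ℝ Φ) ∈ Subtype.val ⁻¹' Φ)
  rw [h.eq_frontier, add_comm]
  exact mem_frontier_body_of_eq hΦmem.1 hu hΦmem.2

/-- If countably many closed sets cover a disc, one of them contains a smaller disc. -/
lemma exists_subdisc {v p : EuclideanSpace ℝ (Fin n)} {ρ : ℝ} (hρ : 0 < ρ)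
    {C : ℕ → Set (EuclideanSpace ℝ (Fin n))} (hC : ∀ k, IsClosed (C k))
    (h : ∀ w, inner ℝ v w = 0 → ‖w‖ < ρ → ∃ k, p + w ∈ C k) :
    ∃ k p', ∃ ρ' > 0, inner ℝ v p' = inner ℝ v p ∧
      ∀ w, inner ℝ v w = 0 → ‖w‖ < ρ' → p' + w ∈ C k := by
  set S : ℕ → Set (ℝ ∙ v)ᗮ := fun k => {w | p + (w : EuclideanSpace ℝ (Fin n)) ∈ C k} with hS
  have hcov : Metric.ball (0 : (ℝ ∙ v)ᗮ) ρ ⊆ ⋃ k, S k := by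
    intro w hw
    have hw' : ‖(w : EuclideanSpace ℝ (Fin n))‖ < ρ := by simpa using hw
    obtain ⟨k, hk⟩ := h w (Submodule.mem_orthogonal_singleton_iff_inner_right.1 w.2) hw'
    exact Set.mem_iUnion.2 ⟨k, hk⟩
  obtain ⟨k, w₀, hw₀⟩ := exists_interior_closure_nonempty Metric.isOpen_ball
    ⟨0, Metric.mem_ball_self hρ⟩ hcov
  have hcl : IsClosed (S k) := (hC k).preimage (by fun_prop)
  rw [hcl.closure_eq] at hw₀
  obtain ⟨ρ', hρ', hball⟩ := Metric.isOpen_iff.1 isOpen_interior w₀ hw₀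
  have hv₀ : inner ℝ v (w₀ : EuclideanSpace ℝ (Fin n)) = 0 :=
    Submodule.mem_orthogonal_singleton_iff_inner_right.1 w₀.2
  refine ⟨k, p + w₀, ρ', hρ', by rw [inner_add_right, hv₀, add_zero], fun w hw hwn => ?_⟩
  have hwm : w ∈ (ℝ ∙ v)ᗮ := Submodule.mem_orthogonal_singleton_iff_inner_right.2 hw
  have hin : w₀ + ⟨w, hwm⟩ ∈ Metric.ball w₀ ρ' := by
    rw [Metric.mem_ball, dist_eq_norm, add_sub_cancel_left]
    exact hwn
  have : p + ((w₀ + ⟨w, hwm⟩ : (ℝ ∙ v)ᗮ) : EuclideanSpace ℝ (Fin n)) ∈ C k :=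
    (interior_subset (hball hin) : w₀ + ⟨w, hwm⟩ ∈ S k)
  rwa [Submodule.coe_add, ← add_assoc] at this

/-- A homothet of a polytope covered by an increasing sequence of closed sets has discs of a common
radius, one in each facet, inside one of the sets. -/
lemma exists_discs_of_homothet (hn : 1 < n) (hPoly : IsPolytopeWith u d P)
    {C : ℕ → Set (EuclideanSpace ℝ (Fin n))} (hC : ∀ k, IsClosed (C k)) (hmono : Monotone C)
    {x : EuclideanSpace ℝ (Fin n)} {r : ℝ} (hr : r ≠ 0) (hx : ∀ y ∈ P, ∃ k, x + r • y ∈ C k) :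
    ∃ k l : ℕ, ∀ i, ∃ p, inner ℝ (u i) p = inner ℝ (u i) x + r * d i ∧
      ∀ w, inner ℝ (u i) w = 0 → ‖w‖ < 1 / ((l : ℝ) + 1) → p + w ∈ C k := by
  have key : ∀ i, ∃ k l : ℕ, ∃ p, inner ℝ (u i) p = inner ℝ (u i) x + r * d i ∧
      ∀ w, inner ℝ (u i) w = 0 → ‖w‖ < 1 / ((l : ℝ) + 1) → p + w ∈ C k := by
    intro i
    obtain ⟨p, ρ, hρ, hp, hdisc⟩ := hPoly.exists_disc hn i
    have hr' : 0 < |r| := abs_pos.2 hr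
    obtain ⟨k, p', ρ', hρ', hp', hdisc'⟩ := exists_subdisc (v := u i) (p := x + r • p)
      (ρ := |r| * ρ) (by positivity) hC fun w hw hwn => by
        have hmem := hdisc (r⁻¹ • w) (by rw [inner_smul_right, hw, mul_zero]) (by
          rw [norm_smul, norm_inv, Real.norm_eq_abs, inv_mul_lt_iff₀ hr']; exact hwn)
        obtain ⟨k, hk⟩ := hx _ hmem
        refine ⟨k, ?_⟩
        rwa [smul_add, smul_inv_smul₀ hr, ← add_assoc] at hk
    -- Restricting radii to `1 / (l + 1)` leaves countably many choices, as needed when Baire's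
    -- theorem is applied to the centres.
    obtain ⟨l, hl⟩ := exists_nat_one_div_lt hρ'
    refine ⟨k, l, p', ?_, fun w hw hwn => hdisc' w hw (hwn.trans hl)⟩
    rw [hp', inner_add_right, inner_smul_right, hp]
  choose k l p hp hdisc using key
  refine ⟨Finset.univ.sup k, Finset.univ.sup l, fun i => ⟨p i, hp i, fun w hw hwn => ?_⟩⟩
  refine hmono (Finset.le_sup (Finset.mem_univ i)) (hdisc i w hw (hwn.trans_le ?_))
  have : (l i : ℝ) ≤ (Finset.univ.sup l : ℕ) := by
    exact_mod_cast Finset.le_sup (f := l) (Finset.mem_univ i)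
  exact one_div_le_one_div_of_le (by positivity) (by linarith)

end Body

/-! ### Centres on the unit segment -/

lemma leastDimP_le_leastDimM {n : ℕ} {P S : Set (EuclideanSpace ℝ (Fin n))} :
    leastDimP P S ≤ leastDimM P S :=
  iInf₂_mono fun B _ => dimP_le_dimM B

lemma inner_of_mem_unitSegment {n : ℕ} [NeZero n] {x : EuclideanSpace ℝ (Fin n)}
    (hx : x ∈ unitSegment n) (v : EuclideanSpace ℝ (Fin n)) : inner ℝ v x = x 0 * v 0 := by
  rw [PiLp.inner_apply, Finset.sum_eq_single 0]
  · simp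
  · intro i _ hi
    simp [hx.2 i hi]
  · simp

lemma norm_le_one_of_mem_unitSegment {n : ℕ} [NeZero n] {x : EuclideanSpace ℝ (Fin n)}
    (hx : x ∈ unitSegment n) : ‖x‖ ≤ 1 := by
  have h := inner_of_mem_unitSegment hx x
  rw [real_inner_self_eq_norm_sq] at h
  nlinarith [norm_nonneg x, hx.1.1, hx.1.2]

lemma single_mem_unitSegment {n : ℕ} [NeZero n] {t : ℝ} (ht : t ∈ Set.Icc (0 : ℝ) 1) :
    EuclideanSpace.single (0 : Fin n) t ∈ unitSegment n :=
  ⟨by simpa using ht, fun i hi => by simp [hi]⟩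

section Harmonic

variable {n s m : ℕ} [NeZero n] {u : Fin s → EuclideanSpace ℝ (Fin n)} {d j : Fin s → ℝ}
  {P : Set (EuclideanSpace ℝ (Fin n))}

/-! ### The upper bound -/

/-- A set with progressions of all differences yields a set containing homothets. -/
lemma exists_containsHomothets (hPoly : IsPolytopeWith u d P) (hH : IsHarmonic u d j m)
    {A : Set ℝ} {t : ℝ} (hA : IsAPSet m A) (hb : BoxBound A t) :
    ∃ B, ContainsHomothets P (unitSegment n) B ∧ BoxBound B (t + ((n : ℝ) - 1)) := by
  obtain ⟨a, q, hq, hrange⟩ := hH.progression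
  -- The ratio built from a progression may vanish; starting the progression one unit later changes
  -- the ratio by `q ≠ 0`.
  set A₂ := A ∪ (fun x => x + 1) '' A with hA₂
  have hb₂ : BoxBound A₂ t := hb.union (hb.add_image 1)
  obtain ⟨R₁, hR₁⟩ := hb₂.isBounded.exists_norm_le
  obtain ⟨R₂, hR₂⟩ := hPoly.bounded.exists_norm_le
  set R := 1 + (|q| * |R₁| + |a|) * |R₂| with hR
  refine ⟨⋃ i, {y | ‖y‖ ≤ R ∧ inner ℝ (u i) y ∈ (fun x => (d i * q) * x) '' A₂}, ?_,
    BoxBound.iUnion fun i => (hb₂.mul_image _).slab (hPoly.norm_normal i) R⟩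
  intro x hx
  obtain ⟨b, hbA⟩ := hA (x 0) hx.1
  obtain ⟨b', hb', hr⟩ : ∃ b', (∀ l : ℕ, l < m → b' + l * x 0 ∈ A₂) ∧ q * b' - x 0 * a ≠ 0 := by
    by_cases h0 : q * b - x 0 * a = 0
    · refine ⟨b + 1, fun l hl => Or.inr ⟨b + l * x 0, hbA l hl, by ring⟩, ?_⟩
      have : q * (b + 1) - x 0 * a = q := by linarith
      rwa [this]
    · exact ⟨b, fun l hl => Or.inl (hbA l hl), h0⟩
  -- With ratio `r = q * b' - x 0 * a`, a face labelled `a + l * q` has normalised distance `x 0 *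
  -- (a + l * q) + r = q * (b' + l * x 0)`, a multiple of a term of the progression.
  refine ⟨_, hr, fun y hy => ?_⟩
  rw [hPoly.eq_frontier] at hy
  obtain ⟨hyb, i, hi⟩ := mem_frontier_body hy
  obtain ⟨l, hl, hjl⟩ : ∃ l : ℕ, l < m ∧ j i = a + l * q := by
    have : j i ∈ Set.range j := ⟨i, rfl⟩
    rw [hrange] at this
    exact this
  refine Set.mem_iUnion.2 ⟨i, ?_, b' + l * x 0, hb' l hl, ?_⟩
  · have hb0 : |b'| ≤ |R₁| := by
      have := hR₁ _ (hb' 0 (by omega))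
      simp only [Nat.cast_zero, zero_mul, add_zero, Real.norm_eq_abs] at this
      exact this.trans (le_abs_self _)
    have hy2 : ‖y‖ ≤ |R₂| := (hR₂ y hyb).trans (le_abs_self _)
    have hrle : |q * b' - x 0 * a| ≤ |q| * |R₁| + |a| := by
      refine (abs_sub _ _).trans ?_
      rw [abs_mul, abs_mul, abs_of_nonneg hx.1.1]
      nlinarith [abs_nonneg q, abs_nonneg a, hx.1.2]
    refine (norm_add_le _ _).trans ?_
    rw [norm_smul, Real.norm_eq_abs]
    exact add_le_add (norm_le_one_of_mem_unitSegment hx)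
      (mul_le_mul hrle hy2 (norm_nonneg _) (by positivity))
  · rw [inner_add_right, inner_smul_right, inner_of_mem_unitSegment hx, hi, ← hH.first_coord i, hjl]
    ring

lemma hM_le (hn : 1 < n) (hPoly : IsPolytopeWith u d P) (hH : IsHarmonic u d j m) :
    hM P ≤ (((n : ℝ) - 1 : ℝ) : EReal) + fM m := by
  have hn' : (1 : ℝ) < n := by exact_mod_cast hn
  rw [add_comm, ← EReal.sub_le_iff_le_add (Or.inl (EReal.coe_ne_bot _))
    (Or.inl (EReal.coe_ne_top _))]
  refine le_iInf₂ fun A hA => EReal.le_of_forall_lt_iff_le.1 fun z hz => ?_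
  have hz0 : 0 ≤ z := by exact_mod_cast ((dimM_nonneg A).trans_lt hz).le
  obtain ⟨B, hB, hBb⟩ := exists_containsHomothets hPoly hH hA (boxBound_of_dimM_lt hz)
  rw [EReal.sub_le_iff_le_add (Or.inl (EReal.coe_ne_bot _)) (Or.inl (EReal.coe_ne_top _)),
    ← EReal.coe_add]
  exact (iInf₂_le B hB).trans (hBb.dimM_le (by linarith))

/-! ### The lower bound -/

/-- Without labels there would be no faces, and the body would be the whole unbounded space. -/
lemma IsHarmonic.length_pos (hPoly : IsPolytopeWith u d P) (hH : IsHarmonic u d j m) :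
    0 < m := by
  rcases Nat.eq_zero_or_pos m with rfl | hm
  · exfalso
    obtain ⟨a, q, -, hrange⟩ := hH.progression
    have hemp : IsEmpty (Fin s) := ⟨fun i => by
      have : j i ∈ Set.range j := ⟨i, rfl⟩
      rw [hrange] at this
      obtain ⟨l, hl, -⟩ := this
      exact absurd hl (Nat.not_lt_zero l)⟩
    have huniv : body u d = Set.univ :=
      Set.eq_univ_of_forall fun y i => (hemp.false i).elim
    have hbd := hPoly.bounded
    rw [huniv] at hbd
    have : Nontrivial (EuclideanSpace ℝ (Fin n)) :=
      ⟨EuclideanSpace.single 0 1, 0, by simp⟩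
    exact NormedSpace.unbounded_univ ℝ (EuclideanSpace ℝ (Fin n)) hbd
  · exact hm

/-- Baire's theorem is used twice. Inside each homothet it yields discs of a common radius in a
single closed piece; across the centres it yields one piece and one radius for a somewhere dense set
of parameters. The distances of those discs, divided by `d i` and by `q`, contain progressions with
these parameters as differences. -/
lemma le_hP (hn : 1 < n) (hPoly : IsPolytopeWith u d P) (hH : IsHarmonic u d j m) :
    (((n : ℝ) - 1 : ℝ) : EReal) + fM m ≤ hP P := by
  obtain ⟨a, q, hq, hrange⟩ := hH.progression
  have hm := hH.length_pos hPoly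
  refine le_iInf₂ fun B hB => le_iInf₂ fun S hS => EReal.le_of_forall_lt_iff_le.1 fun z hz => ?_
  have hb : ∀ k, BoxBound (S k) z := fun k =>
    boxBound_of_dimM_lt ((le_iSup (fun k => dimM (S k)) k).trans_lt hz)
  set C : ℕ → Set (EuclideanSpace ℝ (Fin n)) :=
    fun k => closure (⋃ i ∈ Finset.range (k + 1), S i) with hC
  have hCb : ∀ k, BoxBound (C k) z := fun k => (BoxBound.biUnion _ fun i _ => hb i).closure
  have hmono : Monotone C := fun k k' hk => closure_mono (Set.biUnion_subset_biUnion_left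
    fun i hi => by simp only [Finset.coe_range, Set.mem_Iio] at hi ⊢; omega)
  have hSC : ∀ k, S k ⊆ C k := fun k => subset_closure.trans' fun y hy =>
    Set.mem_biUnion (x := k) (by simp) hy
  -- parameters for which one set and one radius serve all facets
  set T : ℕ × ℕ → Set ℝ := fun c => {t | ∃ r : ℝ, ∀ i, ∃ p,
    inner ℝ (u i) p = d i * (t * j i + r) ∧
      ∀ w, inner ℝ (u i) w = 0 → ‖w‖ < 1 / ((c.2 : ℝ) + 1) → p + w ∈ C c.1} with hT
  have hcov : Set.Ioo (0 : ℝ) 1 ⊆ ⋃ c, T c := by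
    intro t ht
    have hx := single_mem_unitSegment (n := n) (t := t) ⟨ht.1.le, ht.2.le⟩
    obtain ⟨r, hr, hrB⟩ := hB _ hx
    obtain ⟨k, l, hkl⟩ := exists_discs_of_homothet hn hPoly (fun k => isClosed_closure) hmono hr
      fun y hy => (Set.mem_iUnion.1 (hS (hrB y hy))).imp fun k hk => hSC k hk
    refine Set.mem_iUnion.2 ⟨(k, l), r, fun i => ?_⟩
    obtain ⟨p, hp, hdisc⟩ := hkl i
    refine ⟨p, ?_, hdisc⟩
    rw [hp, inner_of_mem_unitSegment hx, ← hH.first_coord i]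
    simp
    ring
  obtain ⟨⟨k, l⟩, hkl⟩ := exists_interior_closure_nonempty isOpen_Ioo
    ⟨1 / 2, by norm_num, by norm_num⟩ hcov
  set V : Fin s → Set ℝ := fun i => {v | ∃ p, inner ℝ (u i) p = v ∧
    ∀ w, inner ℝ (u i) w = 0 → ‖w‖ < 1 / ((l : ℝ) + 1) → p + w ∈ C k} with hV
  have hVb : ∀ i, BoxBound (V i) (z - ((n : ℝ) - 1)) := fun i =>
    (hCb k).of_discs (hPoly.norm_normal i) (ρ := 1 / ((l : ℝ) + 1)) (by positivity) fun v hv => hv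
  set A : Set ℝ := ⋃ i, (fun x => (d i)⁻¹ * x) '' V i with hA
  have hAb : BoxBound A (z - ((n : ℝ) - 1)) := BoxBound.iUnion fun i => (hVb i).mul_image _
  have hAP : ∀ t ∈ T (k, l), ContainsAP m t ((fun x => q⁻¹ * x) '' A) := by
    rintro t ⟨r, hr⟩
    have h1 : ContainsAP m (q * t) A := by
      refine ⟨t * a + r, fun i hi => ?_⟩
      have hmem : a + i * q ∈ Set.range j := by rw [hrange]; exact ⟨i, hi, rfl⟩
      obtain ⟨e, he⟩ := hmem
      refine Set.mem_iUnion.2 ⟨e, d e * (t * j e + r), hr e, ?_⟩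
      simp only
      rw [inv_mul_cancel_left₀ (hH.dist_ne_zero e), he]
      ring
    have h2 := h1.mul_image q⁻¹
    rwa [inv_mul_cancel_left₀ hq] at h2
  have hne : ((fun x => q⁻¹ * x) '' A).Nonempty := by
    obtain ⟨t, ht⟩ : (T (k, l)).Nonempty :=
      closure_nonempty_iff.1 (hkl.mono interior_subset)
    obtain ⟨b, hb⟩ := hAP t ht
    exact ⟨_, hb 0 hm⟩
  have hf := fM_le_of_somewhere_dense ((hAb.mul_image q⁻¹).nonneg hne) (hAb.mul_image q⁻¹) hkl hAP
  calc (((n : ℝ) - 1 : ℝ) : EReal) + fM m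
      ≤ (((n : ℝ) - 1 : ℝ) : EReal) + ((z - ((n : ℝ) - 1) : ℝ) : EReal) := by gcongr
    _ = z := by rw [← EReal.coe_add]; congr 1; ring

lemma hM_eq (hn : 1 < n) (hPoly : IsPolytopeWith u d P) (hH : IsHarmonic u d j m) :
    hM P = (((n : ℝ) - 1 : ℝ) : EReal) + fM m :=
  le_antisymm (hM_le hn hPoly hH) ((le_hP hn hPoly hH).trans leastDimP_le_leastDimM)

lemma hP_eq (hn : 1 < n) (hPoly : IsPolytopeWith u d P) (hH : IsHarmonic u d j m) :
    hP P = (((n : ℝ) - 1 : ℝ) : EReal) + fM m :=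
  le_antisymm (leastDimP_le_leastDimM.trans (hM_le hn hPoly hH)) (le_hP hn hPoly hH)

end Harmonic

/-! ### Integer progressions -/

lemma apNumber_le {k N : ℕ} (A : Finset ℤ)
    (h : ∀ d : ℕ, 1 ≤ d → d ≤ N → ContainsAP k (d : ℤ) (A : Set ℤ)) : apNumber k N ≤ A.card :=
  Nat.sInf_le ⟨A, rfl, h⟩

lemma exists_apNumber (k N : ℕ) : ∃ A : Finset ℤ, A.card = apNumber k N ∧
    ∀ d : ℕ, 1 ≤ d → d ≤ N → ContainsAP k (d : ℤ) (A : Set ℤ) := by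
  refine Nat.sInf_mem (s := {c : ℕ | ∃ A : Finset ℤ, A.card = c ∧
    ∀ d : ℕ, 1 ≤ d → d ≤ N → ContainsAP k (d : ℤ) (A : Set ℤ)})
    ⟨_, Finset.Icc 0 ((k * N : ℕ) : ℤ), rfl, fun d _ hd => ⟨0, fun i hi => ?_⟩⟩
  simp only [zero_add, Finset.coe_Icc, Set.mem_Icc]
  refine ⟨by positivity, ?_⟩
  exact_mod_cast Nat.mul_le_mul hi.le hd

lemma one_le_apNumber {k N : ℕ} (hk : 1 ≤ k) (hN : 1 ≤ N) : 1 ≤ apNumber k N := by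
  obtain ⟨A, hA, hAP⟩ := exists_apNumber k N
  obtain ⟨a, ha⟩ := hAP 1 le_rfl hN
  rw [← hA]
  exact Finset.card_pos.2 ⟨_, ha 0 hk⟩

/-- Discretisation at scale `1 / N` bounds `apNumber k N`. -/
lemma apNumber_le_of_isAPSet {k : ℕ} {A : Set ℝ} {s : ℝ} (hA : IsAPSet k A) (hb : BoxBound A s) :
    ∃ C : ℝ, 0 < C ∧ ∀ N : ℕ, 2 ≤ N → (apNumber k N : ℝ) ≤ C * (N : ℝ) ^ s := by
  classical
  obtain ⟨C, hC, hF⟩ := hb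
  refine ⟨3 * C, by positivity, fun N hN => ?_⟩
  have hN2 : (2 : ℝ) ≤ N := by exact_mod_cast hN
  have hN0 : (0 : ℝ) < N := by linarith
  obtain ⟨F, hFc, hcov⟩ := hF (1 / N) (by positivity) (by rw [div_lt_one hN0]; linarith)
  rw [one_div, Real.inv_rpow hN0.le, Real.rpow_neg hN0.le, inv_inv] at hFc
  -- Points within `1 / N` of each other have `⌊N * x⌋` differing by at most one, hence three
  -- integers per centre.
  set G := F.biUnion fun y => Finset.Icc (⌊N * y⌋ - 1) (⌊N * y⌋ + 1) with hG
  have hGc : G.card ≤ 3 * F.card := by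
    refine Finset.card_biUnion_le.trans ?_
    rw [mul_comm, ← smul_eq_mul, ← Finset.sum_const]
    refine Finset.sum_le_sum fun y _ => ?_
    rw [Int.card_Icc]
    omega
  have hmem : ∀ x ∈ A, ⌊N * x⌋ ∈ G := fun x hx => by
    obtain ⟨y, hy, hxy⟩ := hcov x hx
    rw [Real.dist_eq, abs_le, neg_le_iff_add_nonneg, ← neg_le_iff_add_nonneg'] at hxy
    have e1 : N * x ≤ N * y + 1 := by
      have := mul_le_mul_of_nonneg_left hxy.2 hN0.le
      rw [mul_sub, mul_one_div_cancel hN0.ne'] at this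
      linarith
    have e2 : N * y ≤ N * x + 1 := by
      have := mul_le_mul_of_nonneg_left hxy.1 hN0.le
      rw [mul_neg, mul_sub, mul_one_div_cancel hN0.ne'] at this
      linarith
    refine Finset.mem_biUnion.2 ⟨y, hy, Finset.mem_Icc.2 ⟨?_, ?_⟩⟩
    · have := Int.floor_mono e2
      rw [Int.floor_add_one] at this
      omega
    · have := Int.floor_mono e1
      rwa [Int.floor_add_one] at this
  have hle : apNumber k N ≤ G.card := by
    refine apNumber_le G fun d _ hdN => ?_
    have hdN' : (d : ℝ) ≤ N := by exact_mod_cast hdN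
    obtain ⟨a, ha⟩ := hA (d / N) ⟨by positivity, by rw [div_le_one hN0]; exact hdN'⟩
    refine ⟨⌊N * a⌋, fun i hi => ?_⟩
    have h1 := hmem _ (ha i hi)
    -- Multiplying by `N` makes the increments integers, so taking floors preserves the progression
    -- exactly.
    have h2 : (N : ℝ) * (a + i * (d / N)) = N * a + ((i * d : ℤ) : ℝ) := by
      push_cast
      field_simp
    rw [h2, Int.floor_add_intCast] at h1
    exact_mod_cast h1
  calc (apNumber k N : ℝ) ≤ ((3 * F.card : ℕ) : ℝ) := by exact_mod_cast hle.trans hGc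
    _ = 3 * F.card := by push_cast; ring
    _ ≤ 3 * (C * (N : ℝ) ^ s) := by linarith
    _ = _ := by ring

/-! ### Self-similar sets -/

/-- The `J`-th approximation to the self-similar set with maps `x ↦ (a + x) / N`, `a ∈ A`,
started at `e`. -/
noncomputable def digitSet (A : Finset ℤ) (N : ℕ) (e : ℝ) : ℕ → Finset ℝ
  | 0 => {e}
  | J + 1 => (A ×ˢ digitSet A N e J).image fun q => ((q.1 : ℝ) + q.2) / N

section DigitSet

variable {A : Finset ℤ} {N : ℕ} {e : ℝ}

lemma mem_digitSet_succ {J : ℕ} {x : ℝ} : x ∈ digitSet A N e (J + 1) ↔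
    ∃ a ∈ A, ∃ y ∈ digitSet A N e J, ((a : ℝ) + y) / N = x := by
  simp only [digitSet, Finset.mem_image, Finset.mem_product, Prod.exists]
  constructor
  · rintro ⟨a, y, ⟨ha, hy⟩, h⟩
    exact ⟨a, ha, y, hy, h⟩
  · rintro ⟨a, ha, y, hy, h⟩
    exact ⟨a, y, ⟨ha, hy⟩, h⟩

lemma card_digitSet_le (J : ℕ) : (digitSet A N e J).card ≤ A.card ^ J := by
  induction J with
  | zero => simp [digitSet]
  | succ J ih =>
    refine Finset.card_image_le.trans ?_
    rw [Finset.card_product, pow_succ']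
    exact Nat.mul_le_mul_left _ ih

/-- Starting at the fixed point of one of the maps makes the approximations nested. -/
lemma digitSet_subset_succ {a₀ : ℤ} (ha₀ : a₀ ∈ A) (he : ((a₀ : ℝ) + e) / N = e) (J : ℕ) :
    digitSet A N e J ⊆ digitSet A N e (J + 1) := by
  induction J with
  | zero =>
    intro x hx
    rw [digitSet, Finset.mem_singleton] at hx
    subst hx
    exact mem_digitSet_succ.2 ⟨a₀, ha₀, x, by simp [digitSet], he⟩
  | succ J ih =>
    intro x hx
    obtain ⟨a, ha, y, hy, hx⟩ := mem_digitSet_succ.1 hx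
    exact mem_digitSet_succ.2 ⟨a, ha, y, ih hy, hx⟩

lemma abs_le_of_mem_digitSet {K : ℝ} (hN : 2 ≤ N) (hA : ∀ a ∈ A, |(a : ℝ)| ≤ K) (he : |e| ≤ K)
    {J : ℕ} {x : ℝ} (hx : x ∈ digitSet A N e J) : |x| ≤ K := by
  have hN2 : (2 : ℝ) ≤ N := by exact_mod_cast hN
  induction J generalizing x with
  | zero =>
    rw [digitSet, Finset.mem_singleton] at hx
    rwa [hx]
  | succ J ih =>
    obtain ⟨a, ha, y, hy, rfl⟩ := mem_digitSet_succ.1 hx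
    rw [abs_div, abs_of_pos (by linarith : (0 : ℝ) < N), div_le_iff₀ (by linarith)]
    have := abs_add_le (a : ℝ) y
    have h1 := hA a ha
    have h2 := ih hy
    nlinarith [abs_nonneg y]

/-- Points of later approximations are close to earlier ones. -/
lemma exists_near_digitSet {K : ℝ} (hN : 2 ≤ N) (hA : ∀ a ∈ A, |(a : ℝ)| ≤ K) (he : |e| ≤ K)
    (J : ℕ) {i : ℕ} {x : ℝ} (hx : x ∈ digitSet A N e (i + J)) :
    ∃ y ∈ digitSet A N e J, |x - y| ≤ 2 * K / (N : ℝ) ^ J := by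
  have hN2 : (2 : ℝ) ≤ N := by exact_mod_cast hN
  have hN0 : (0 : ℝ) < N := by linarith
  induction J generalizing x with
  | zero =>
    refine ⟨e, by simp [digitSet], ?_⟩
    have h1 := abs_le_of_mem_digitSet hN hA he hx
    have := abs_sub x e
    rw [pow_zero, div_one]
    linarith
  | succ J ih =>
    obtain ⟨a, ha, y, hy, rfl⟩ := mem_digitSet_succ.1 (by rwa [← add_assoc] at hx)
    obtain ⟨z, hz, hyz⟩ := ih hy
    refine ⟨((a : ℝ) + z) / N, mem_digitSet_succ.2 ⟨a, ha, z, hz, rfl⟩, ?_⟩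
    have h1 : ((a : ℝ) + y) / N - ((a : ℝ) + z) / N = (y - z) / N := by ring
    rw [h1, abs_div, abs_of_pos hN0, pow_succ, ← div_div]
    exact div_le_div_of_nonneg_right hyz hN0.le

/-- At level `J ≈ log (1 / ε) / log N` there are at most `A.card ^ J` points. By nesting every point
of the union lies in some level beyond `J`, hence within `ε` of level `J`. -/
lemma boxBound_iUnion_digitSet {K : ℝ} (hN : 2 ≤ N) (hA : ∀ a ∈ A, |(a : ℝ)| ≤ K)
    {a₀ : ℤ} (ha₀ : a₀ ∈ A) (hfix : ((a₀ : ℝ) + e) / N = e) (he : |e| ≤ K) :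
    BoxBound (⋃ J, (digitSet A N e J : Set ℝ)) (Real.log A.card / Real.log N) := by
  have hN2 : (2 : ℝ) ≤ N := by exact_mod_cast hN
  have hN0 : (0 : ℝ) < N := by linarith
  have hlogN : 0 < Real.log N := Real.log_pos (by linarith)
  have hc1 : (1 : ℝ) ≤ A.card := by exact_mod_cast Finset.card_pos.2 ⟨a₀, ha₀⟩
  have hc0 : (0 : ℝ) < A.card := by linarith
  have hlogc : 0 ≤ Real.log A.card := Real.log_nonneg hc1
  have hmono : Monotone (digitSet A N e) :=
    monotone_nat_of_le_succ fun J => digitSet_subset_succ ha₀ hfix J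
  set s := Real.log A.card / Real.log N with hs
  set M := max (2 * K) 1 with hM
  have hM1 : 1 ≤ M := le_max_right _ _
  refine ⟨A.card * M ^ s, by positivity, fun ε h1 h2 => ?_⟩
  have hMε : 1 ≤ M / ε := by rw [le_div_iff₀ h1]; linarith
  set J := ⌈Real.log (M / ε) / Real.log N⌉₊ with hJ
  have hnn : 0 ≤ Real.log (M / ε) / Real.log N := div_nonneg (Real.log_nonneg hMε) hlogN.le
  have hJ1 : Real.log (M / ε) / Real.log N ≤ J := Nat.le_ceil _
  have hJ2 : (J : ℝ) ≤ Real.log (M / ε) / Real.log N + 1 := (Nat.ceil_lt_add_one hnn).le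
  refine ⟨digitSet A N e J, ?_, ?_⟩
  · have hcard : ((digitSet A N e J).card : ℝ) ≤ (A.card : ℝ) ^ J := by
      exact_mod_cast card_digitSet_le J
    refine hcard.trans ?_
    have hexp : (A.card : ℝ) ^ J ≤ A.card * (M / ε) ^ s := by
      rw [← Real.log_le_log_iff (by positivity) (by positivity), Real.log_pow,
        Real.log_mul hc0.ne' (by positivity), Real.log_rpow (by positivity)]
      have := mul_le_mul_of_nonneg_right hJ2 hlogc
      refine this.trans (le_of_eq ?_)
      rw [hs]
      field_simp
      ring
    refine hexp.trans (le_of_eq ?_)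
    rw [Real.div_rpow (by positivity) h1.le, Real.rpow_neg h1.le]
    ring
  · intro x hx
    obtain ⟨i, hi⟩ := Set.mem_iUnion.1 hx
    have hi' : x ∈ digitSet A N e (i + J) := hmono (Nat.le_add_right i J) hi
    obtain ⟨y, hy, hxy⟩ := exists_near_digitSet hN hA he J hi'
    refine ⟨y, hy, ?_⟩
    rw [Real.dist_eq]
    refine hxy.trans ?_
    have hpow : M / ε ≤ (N : ℝ) ^ J := by
      rw [← Real.log_le_log_iff (by positivity) (by positivity), Real.log_pow]
      rwa [div_le_iff₀ hlogN] at hJ1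
    rw [div_le_iff₀ (by positivity)]
    rw [div_le_iff₀ h1] at hpow
    have : 2 * K ≤ M := le_max_left _ _
    linarith

/-- The difference is built digit by digit: writing `p = D * N ^ J + r`, the termwise sum of a digit
progression with difference `D` and a progression with difference `r / N ^ J`, divided by `N`, has
difference `p / N ^ (J + 1)`. -/
lemma containsAP_digitSet {k : ℕ} (hA : ∀ d : ℕ, d < N → ContainsAP k (d : ℤ) (A : Set ℤ))
    (hN : 0 < N) (J : ℕ) {p : ℕ} (hp : p < N ^ J) :
    ContainsAP k ((p : ℝ) / (N : ℝ) ^ J) (digitSet A N e J : Set ℝ) := by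
  have hN0 : (0 : ℝ) < N := by exact_mod_cast hN
  induction J generalizing p with
  | zero =>
    have : p = 0 := by simpa using hp
    subst this
    exact ⟨e, fun i _ => by simp [digitSet]⟩
  | succ J ih =>
    have hpos : 0 < N ^ J := pow_pos hN J
    obtain ⟨x, hx⟩ := ih (Nat.mod_lt p hpos)
    obtain ⟨b, hb⟩ := hA (p / N ^ J) (by
      rw [Nat.div_lt_iff_lt_mul hpos, ← pow_succ']; exact hp)
    refine ⟨((b : ℝ) + x) / N, fun i hi => ?_⟩
    refine mem_digitSet_succ.2 ⟨_, hb i hi, _, hx i hi, ?_⟩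
    have hdm : (p : ℝ) = (N : ℝ) ^ J * ((p / N ^ J : ℕ) : ℝ) + ((p % N ^ J : ℕ) : ℝ) := by
      exact_mod_cast (Nat.div_add_mod p (N ^ J)).symm
    generalize p / N ^ J = D at hdm ⊢
    generalize p % N ^ J = r at hdm ⊢
    rw [hdm]
    push_cast
    field_simp
    ring

end DigitSet

lemma Ioo_subset_closure_fractions {N : ℕ} (hN : 2 ≤ N) :
    Set.Ioo (0 : ℝ) 1 ⊆ closure {t | ∃ J p : ℕ, p < N ^ J ∧ t = (p : ℝ) / (N : ℝ) ^ J} := by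
  have hN2 : (2 : ℝ) ≤ N := by exact_mod_cast hN
  have hN0 : (0 : ℝ) < N := by linarith
  intro t ht
  rw [Metric.mem_closure_iff]
  intro ε hε
  obtain ⟨J, hJ⟩ := exists_pow_lt_of_lt_one hε (show (1 : ℝ) / N < 1 by
    rw [div_lt_one hN0]; linarith)
  have hpos : (0 : ℝ) < (N : ℝ) ^ J := by positivity
  have hfl := Nat.floor_le (show 0 ≤ t * (N : ℝ) ^ J from mul_nonneg ht.1.le hpos.le)
  have hfl2 := Nat.lt_floor_add_one (t * (N : ℝ) ^ J)
  refine ⟨_, ⟨J, ⌊t * (N : ℝ) ^ J⌋₊, ?_, rfl⟩, ?_⟩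
  · have : ((⌊t * (N : ℝ) ^ J⌋₊ : ℕ) : ℝ) < ((N ^ J : ℕ) : ℝ) := by
      push_cast
      nlinarith [ht.2]
    exact_mod_cast this
  · rw [Real.dist_eq]
    have h1 : t - (⌊t * (N : ℝ) ^ J⌋₊ : ℝ) / (N : ℝ) ^ J =
        (t * (N : ℝ) ^ J - ⌊t * (N : ℝ) ^ J⌋₊) / (N : ℝ) ^ J := by field_simp
    rw [one_div, inv_pow, ← one_div] at hJ
    rw [h1, abs_of_nonneg (div_nonneg (by linarith) hpos.le)]
    refine lt_of_le_of_lt (div_le_div_of_nonneg_right ?_ hpos.le) hJ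
    linarith

/-- The self-similar set with digits in an optimal integer set has progressions with all `N`-adic
differences in `[0, 1)`. These are dense, which suffices for `fM_le_of_somewhere_dense`. -/
lemma fM_le_log_apNumber {k N : ℕ} (hk : 1 ≤ k) (hN : 2 ≤ N) :
    fM k ≤ ((Real.log (apNumber k N) / Real.log N : ℝ) : EReal) := by
  have hN2 : (2 : ℝ) ≤ N := by exact_mod_cast hN
  obtain ⟨A, hAc, hAP⟩ := exists_apNumber k N
  obtain ⟨a₀, ha₀⟩ : A.Nonempty := by
    rw [← Finset.card_pos, hAc]; exact one_le_apNumber hk (by omega)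
  set K : ℝ := ∑ a ∈ A, |(a : ℝ)| with hK
  have hAK : ∀ a ∈ A, |(a : ℝ)| ≤ K := fun a ha =>
    Finset.single_le_sum (f := fun a : ℤ => |(a : ℝ)|) (fun _ _ => abs_nonneg _) ha
  set e : ℝ := (a₀ : ℝ) / (N - 1) with he
  have hfix : ((a₀ : ℝ) + e) / N = e := by
    have : (N : ℝ) - 1 ≠ 0 := by linarith
    rw [he]
    field_simp
    ring
  have heK : |e| ≤ K := by
    rw [he, abs_div, abs_of_pos (by linarith : (0 : ℝ) < N - 1), div_le_iff₀ (by linarith)]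
    have h1 := hAK a₀ ha₀
    nlinarith [abs_nonneg (a₀ : ℝ)]
  have hb := boxBound_iUnion_digitSet hN hAK ha₀ hfix heK
  have hAP' : ∀ d : ℕ, d < N → ContainsAP k (d : ℤ) (A : Set ℤ) := fun d hd => by
    rcases Nat.eq_zero_or_pos d with rfl | h
    · exact ⟨a₀, fun i _ => by simpa using ha₀⟩
    · exact hAP d h hd.le
  rw [← hAc]
  refine fM_le_of_somewhere_dense (hb.nonneg ⟨e, Set.mem_iUnion.2 ⟨0, by simp [digitSet]⟩⟩) hb
    (T := {t | ∃ J p : ℕ, p < N ^ J ∧ t = (p : ℝ) / (N : ℝ) ^ J}) ?_ ?_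
  · exact ⟨1 / 2, interior_maximal (Ioo_subset_closure_fractions hN) isOpen_Ioo
      ⟨by norm_num, by norm_num⟩⟩
  · rintro t ⟨J, p, hp, rfl⟩
    exact (containsAP_digitSet hAP' (by omega) J hp).mono
      (Set.subset_iUnion (fun J => (digitSet A N e J : Set ℝ)) J)

/-! ### The arithmetic Kakeya conjecture in terms of `fM` -/

lemma fM_mono : Monotone fM := fun _ _ h =>
  iInf_mono fun _ => iInf_mono' fun hA =>
    ⟨fun t ht => (hA t ht).imp fun _ ha i hi => ha i (hi.trans_le h), le_rfl⟩

lemma coe_toReal_fM (k : ℕ) : (((fM k).toReal : ℝ) : EReal) = fM k := by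
  refine EReal.coe_toReal (ne_top_of_le_ne_top (EReal.coe_ne_top _)
    ((fM_mono (Nat.le_succ k)).trans (fM_le_log_apNumber (N := 2) (Nat.succ_pos k) le_rfl))) ?_
  exact ne_bot_of_le_ne_bot EReal.zero_ne_bot (fM_nonneg k)

lemma toReal_fM_mono : Monotone fun k => (fM k).toReal := fun k k' h => by
  have := fM_mono h
  rw [← coe_toReal_fM k, ← coe_toReal_fM k'] at this
  exact_mod_cast this

/-- The self-similar construction bounds every term with `N ≥ 2` from below by `fM k`. Discretising
a nearly optimal set bounds the terms from above, with the error `log C / log N → 0`. -/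
lemma tendsto_log_apNumber {k : ℕ} (hk : 1 ≤ k) :
    Tendsto (fun N : ℕ => Real.log (apNumber k N) / Real.log N) atTop (𝓝 (fM k).toReal) := by
  rw [tendsto_order]
  refine ⟨fun c hc => ?_, fun c hc => ?_⟩
  · filter_upwards [eventually_ge_atTop 2] with N hN
    have := fM_le_log_apNumber hk hN
    rw [← coe_toReal_fM k] at this
    exact hc.trans_le (by exact_mod_cast this)
  · obtain ⟨z, hz1, hz2⟩ := exists_between hc
    have hz : fM k < z := by rw [← coe_toReal_fM k]; exact_mod_cast hz1
    obtain ⟨A, hA, hAz⟩ : ∃ A, IsAPSet k A ∧ dimM A < z := by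
      simpa [fM, iInf_lt_iff] using hz
    obtain ⟨C, hC, hle⟩ := apNumber_le_of_isAPSet hA (boxBound_of_dimM_lt hAz)
    have hlog : Tendsto (fun N : ℕ => Real.log (N : ℝ)) atTop atTop :=
      Real.tendsto_log_atTop.comp tendsto_natCast_atTop_atTop
    have hlim : Tendsto (fun N : ℕ => Real.log C / Real.log N + z) atTop (𝓝 z) := by
      simpa using (hlog.const_div_atTop (Real.log C)).add_const z
    filter_upwards [eventually_ge_atTop 2, hlim.eventually (gt_mem_nhds hz2)] with N hN hlt
    refine lt_of_le_of_lt ?_ hlt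
    have hN2 : (2 : ℝ) ≤ N := by exact_mod_cast hN
    have hN0 : (0 : ℝ) < N := by linarith
    have hlogN : 0 < Real.log N := Real.log_pos (by linarith)
    have h1 : (1 : ℝ) ≤ apNumber k N := by exact_mod_cast one_le_apNumber hk (by omega)
    have h2 := Real.log_le_log (by linarith) (hle N hN)
    rw [Real.log_mul hC.ne' (by positivity), Real.log_rpow hN0] at h2
    rw [div_add' _ _ _ hlogN.ne']
    exact div_le_div_of_nonneg_right h2 hlogN.le

lemma arithmeticKakeya_iff :
    ArithmeticKakeya ↔ Tendsto (fun k => (fM k).toReal) atTop (𝓝 1) := by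
  constructor
  · rintro ⟨L, hL, hL1⟩
    refine hL1.congr' ?_
    filter_upwards [eventually_ge_atTop 1] with k hk
    exact tendsto_nhds_unique (hL k hk) (tendsto_log_apNumber hk)
  · exact fun h => ⟨_, fun k hk => tendsto_log_apNumber hk, h⟩

/-! ### Polytopes circumscribed about the unit sphere -/

/-- A point of the sphere can be moved to a prescribed first coordinate `c` at squared cost
`4 * |y 0 - c|`. -/
lemma exists_sphere_near {n : ℕ} [NeZero n] (hn : 1 < n) {y : EuclideanSpace ℝ (Fin n)}
    (hy : ‖y‖ = 1) {c : ℝ} (hc : |c| ≤ 1) :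
    ∃ y' : EuclideanSpace ℝ (Fin n), ‖y'‖ = 1 ∧ y' 0 = c ∧ ‖y - y'‖ ^ 2 ≤ 4 * |y 0 - c| := by
  set e : EuclideanSpace ℝ (Fin n) := EuclideanSpace.single 0 1 with he
  have hen : ‖e‖ = 1 := by simp [he]
  have hei : ∀ z : EuclideanSpace ℝ (Fin n), inner ℝ e z = z 0 := fun z => by
    simp [he, EuclideanSpace.inner_single_left]
  set w := y - y 0 • e with hw
  have hew : inner ℝ e w = 0 := by
    rw [hw, inner_sub_right, inner_smul_right, real_inner_self_eq_norm_sq, hen, hei]; ring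
  have expand : ∀ (a b : ℝ) (v : EuclideanSpace ℝ (Fin n)), ‖v‖ = 1 → inner ℝ e v = 0 →
      ‖a • e + b • v‖ ^ 2 = a ^ 2 + b ^ 2 := fun a b v hv hev => by
    rw [norm_add_sq_real, inner_smul_left, inner_smul_right, hev, norm_smul, norm_smul, hv, hen]
    simp
  -- At a pole the direction `v` is not determined; any second coordinate direction serves, which is
  -- where `1 < n` enters.
  obtain ⟨v, hv, hev, hwv⟩ : ∃ v : EuclideanSpace ℝ (Fin n), ‖v‖ = 1 ∧ inner ℝ e v = 0 ∧
      w = ‖w‖ • v := by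
    by_cases hw0 : w = 0
    · have h10 : (⟨1, hn⟩ : Fin n) ≠ 0 := by
        intro h
        have := congrArg Fin.val h
        simp at this
      refine ⟨EuclideanSpace.single ⟨1, hn⟩ 1, by simp, ?_, by simp [hw0]⟩
      rw [hei]
      simp [h10.symm]
    · have hwn : ‖w‖ ≠ 0 := norm_ne_zero_iff.2 hw0
      refine ⟨‖w‖⁻¹ • w, ?_, ?_, ?_⟩
      · rw [norm_smul, norm_inv, norm_norm, inv_mul_cancel₀ hwn]
      · rw [inner_smul_right, hew, mul_zero]
      · rw [smul_inv_smul₀ hwn]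
  have hyv : y = y 0 • e + ‖w‖ • v := by rw [← hwv, hw]; abel
  have hnorm : y 0 ^ 2 + ‖w‖ ^ 2 = 1 := by
    rw [← expand _ _ v hv hev, ← hyv, hy]; norm_num
  have hc2 : c ^ 2 ≤ 1 := by rw [← sq_abs]; nlinarith [abs_nonneg c]
  set b := √(1 - c ^ 2) with hb
  have hb2 : b ^ 2 = 1 - c ^ 2 := Real.sq_sqrt (by linarith)
  have hb0 : 0 ≤ b := Real.sqrt_nonneg _
  refine ⟨c • e + b • v, ?_, ?_, ?_⟩
  · have := expand c b v hv hev
    rw [hb2] at this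
    have h0 := norm_nonneg (c • e + b • v)
    nlinarith
  · rw [← hei, inner_add_right, inner_smul_right, inner_smul_right, hev,
      real_inner_self_eq_norm_sq, hen]
    ring
  · have heq : y - (c • e + b • v) = (y 0 - c) • e + (‖w‖ - b) • v := by
      nth_rewrite 1 [hyv]
      simp only [sub_smul]
      abel
    rw [heq, expand _ _ v hv hev]
    have hy0 : |y 0| ≤ 1 := by
      rw [← abs_one, ← sq_le_sq]; nlinarith [norm_nonneg w]
    -- For nonnegative numbers `(p - b) ^ 2 ≤ |p ^ 2 - b ^ 2|`, and on the sphere `‖w‖ ^ 2 - b ^ 2 =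
    -- c ^ 2 - y 0 ^ 2`.
    have h1 : (‖w‖ - b) ^ 2 ≤ |y 0 - c| * 2 := by
      have e1 : (‖w‖ - b) ^ 2 ≤ |‖w‖ ^ 2 - b ^ 2| := by
        rw [sq_sub_sq, abs_mul, abs_of_nonneg (by positivity : 0 ≤ ‖w‖ + b), ← sq_abs, sq]
        refine mul_le_mul_of_nonneg_right ?_ (abs_nonneg _)
        rw [abs_le]
        constructor <;> linarith [norm_nonneg w]
      refine e1.trans ?_
      have e2 : ‖w‖ ^ 2 - b ^ 2 = -((y 0 - c) * (y 0 + c)) := by nlinarith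
      rw [e2, abs_neg, abs_mul]
      refine mul_le_mul_of_nonneg_left ?_ (abs_nonneg _)
      exact (abs_add_le _ _).trans (by linarith)
    have h2 : (y 0 - c) ^ 2 ≤ |y 0 - c| * 2 := by
      rw [← sq_abs, sq]
      refine mul_le_mul_of_nonneg_left ?_ (abs_nonneg _)
      exact (abs_sub _ _).trans (by linarith)
    linarith

/-- A finite net of the sphere whose first coordinates are exactly the multiples of `1 / r ^ 2` in
`[-1, 1]`. -/
lemma exists_sphere_net {n : ℕ} [NeZero n] (hn : 1 < n) {r : ℕ} (hr : 1 ≤ r) :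
    ∃ Q : Finset (EuclideanSpace ℝ (Fin n)), (∀ v ∈ Q, ‖v‖ = 1) ∧
      (∀ y : EuclideanSpace ℝ (Fin n), ‖y‖ = 1 → ∃ v ∈ Q, ‖y - v‖ ≤ 3 / r) ∧
      {t : ℝ | ∃ v ∈ Q, v 0 = t} =
        {t : ℝ | ∃ l : ℕ, l < 2 * r ^ 2 + 1 ∧ t = -1 + l * (1 / (r : ℝ) ^ 2)} := by
  classical
  have hr1 : (1 : ℝ) ≤ r := by exact_mod_cast hr
  have hr0 : (0 : ℝ) < r := by linarith
  have hr2 : (0 : ℝ) < (r : ℝ) ^ 2 := by positivity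
  obtain ⟨Z, hZs, hZf, hZc⟩ := (isCompact_sphere (0 : EuclideanSpace ℝ (Fin n)) 1).finite_cover_balls
    (show (0 : ℝ) < 1 / r by positivity)
  have hZs' : ∀ z ∈ Z, ‖z‖ = 1 := fun z hz => by simpa using hZs hz
  set c : ℕ → ℝ := fun l => -1 + l * (1 / (r : ℝ) ^ 2) with hc
  have hc1 : ∀ l, l < 2 * r ^ 2 + 1 → |c l| ≤ 1 := fun l hl => by
    have h1 : (l : ℝ) ≤ 2 * (r : ℝ) ^ 2 := by exact_mod_cast Nat.lt_succ_iff.1 hl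
    have h2 : (l : ℝ) * (1 / (r : ℝ) ^ 2) ≤ 2 := by
      rw [mul_one_div, div_le_iff₀ hr2]; exact h1
    have h3 : 0 ≤ (l : ℝ) * (1 / (r : ℝ) ^ 2) := by positivity
    rw [abs_le]
    constructor <;> simp only [hc] <;> linarith
  choose! g hg1 hg2 hg3 using fun (z : EuclideanSpace ℝ (Fin n)) (hz : ‖z‖ = 1) (t : ℝ)
    (ht : |t| ≤ 1) => exists_sphere_near hn hz ht
  refine ⟨(hZf.toFinset ×ˢ Finset.range (2 * r ^ 2 + 1)).image fun q => g q.1 (c q.2), ?_, ?_, ?_⟩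
  · intro v hv
    obtain ⟨⟨z, l⟩, hq, rfl⟩ := Finset.mem_image.1 hv
    obtain ⟨hz, hl⟩ := Finset.mem_product.1 hq
    exact hg1 z (hZs' z (by simpa using hz)) _ (hc1 l (Finset.mem_range.1 hl))
  · intro y hy
    obtain ⟨z, hz, hyz⟩ : ∃ z ∈ Z, dist y z < 1 / r := by
      simpa using hZc (show y ∈ Metric.sphere 0 1 by simpa using hy)
    have hz0 : |z 0| ≤ 1 := (PiLp.norm_apply_le z 0).trans (hZs' z hz).le
    rw [abs_le] at hz0
    -- Rounding down to spacing `1 / r ^ 2` moves the point by at most `2 / r`, because the squared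
    -- displacement is at most four times the change of coordinate.
    set l := ⌊(z 0 + 1) * (r : ℝ) ^ 2⌋₊ with hl
    have hnn : 0 ≤ (z 0 + 1) * (r : ℝ) ^ 2 := mul_nonneg (by linarith) hr2.le
    have hl1 := Nat.floor_le hnn
    have hl2 := Nat.lt_floor_add_one ((z 0 + 1) * (r : ℝ) ^ 2)
    have hlt : l < 2 * r ^ 2 + 1 := by
      have : (l : ℝ) ≤ ((2 * r ^ 2 : ℕ) : ℝ) := by push_cast; nlinarith
      exact Nat.lt_succ_iff.2 (by exact_mod_cast this)
    refine ⟨g z (c l), Finset.mem_image.2 ⟨(z, l), Finset.mem_product.2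
      ⟨by simpa using hz, Finset.mem_range.2 hlt⟩, rfl⟩, ?_⟩
    have h3 := hg3 z (hZs' z hz) (c l) (hc1 l hlt)
    have h4 : |z 0 - c l| ≤ 1 / (r : ℝ) ^ 2 := by
      have : z 0 - c l = ((z 0 + 1) * (r : ℝ) ^ 2 - l) / (r : ℝ) ^ 2 := by
        simp only [hc]; field_simp; ring
      rw [this, abs_of_nonneg (div_nonneg (by linarith) hr2.le)]
      exact div_le_div_of_nonneg_right (by linarith) hr2.le
    have h5 : ‖z - g z (c l)‖ ≤ 2 / r := by
      refine (pow_le_pow_iff_left₀ (norm_nonneg _) (by positivity) two_ne_zero).1 (h3.trans ?_)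
      rw [div_pow]
      calc 4 * |z 0 - c l| ≤ 4 * (1 / (r : ℝ) ^ 2) := by linarith
        _ = 2 ^ 2 / (r : ℝ) ^ 2 := by ring
    rw [dist_eq_norm] at hyz
    calc ‖y - g z (c l)‖ ≤ ‖y - z‖ + ‖z - g z (c l)‖ := norm_sub_le_norm_sub_add_norm_sub _ _ _
      _ ≤ 1 / r + 2 / r := add_le_add hyz.le h5
      _ = 3 / r := by ring
  · ext t
    constructor
    · rintro ⟨v, hv, rfl⟩
      obtain ⟨⟨z, l⟩, hq, rfl⟩ := Finset.mem_image.1 hv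
      obtain ⟨hz, hl⟩ := Finset.mem_product.1 hq
      exact ⟨l, Finset.mem_range.1 hl, hg2 z (hZs' z (by simpa using hz)) _
        (hc1 l (Finset.mem_range.1 hl))⟩
    · rintro ⟨l, hl, rfl⟩
      have he : ‖EuclideanSpace.single (0 : Fin n) (1 : ℝ)‖ = 1 := by simp
      obtain ⟨z, hz, -⟩ : ∃ z ∈ Z, dist (EuclideanSpace.single (0 : Fin n) (1 : ℝ)) z < 1 / r := by
        simpa using hZc (show EuclideanSpace.single (0 : Fin n) (1 : ℝ) ∈ Metric.sphere 0 1 by simp)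
      exact ⟨_, Finset.mem_image.2 ⟨(z, l), Finset.mem_product.2
        ⟨by simpa using hz, Finset.mem_range.2 hl⟩, rfl⟩, hg2 z (hZs' z hz) _ (hc1 l hl)⟩

section Circumscribed

variable {n s : ℕ} {u : Fin s → EuclideanSpace ℝ (Fin n)} {δ : ℝ}

/-- A normal within `δ` of `y / ‖y‖` has inner product at least `1 - δ ^ 2 / 2` with it, so `‖y‖ *
(1 - δ ^ 2 / 2) ≤ 1`. This forces the bound, since `(1 + δ) * (1 - δ ^ 2 / 2) - 1 = δ * (1 - δ) * (2
+ δ) / 2 ≥ 0`. -/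
lemma norm_le_of_mem_circumscribed (hu : ∀ i, ‖u i‖ = 1) (hδ0 : 0 ≤ δ) (hδ : δ ≤ 1)
    (hnet : ∀ y : EuclideanSpace ℝ (Fin n), ‖y‖ = 1 → ∃ i, ‖y - u i‖ ≤ δ)
    {y : EuclideanSpace ℝ (Fin n)} (hy : y ∈ body u fun _ => 1) : ‖y‖ ≤ 1 + δ := by
  rcases eq_or_ne y 0 with rfl | hy0
  · simp; linarith
  have hyn : 0 < ‖y‖ := norm_pos_iff.2 hy0
  obtain ⟨i, hi⟩ := hnet (‖y‖⁻¹ • y) (by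
    rw [norm_smul, norm_inv, norm_norm, inv_mul_cancel₀ hyn.ne'])
  have h1 : ‖‖y‖⁻¹ • y - u i‖ ^ 2 ≤ δ ^ 2 := pow_le_pow_left₀ (norm_nonneg _) hi 2
  rw [norm_sub_sq_real, hu i, norm_smul, norm_inv, norm_norm, inv_mul_cancel₀ hyn.ne',
    inner_smul_left, real_inner_comm] at h1
  have h2 : inner ℝ (u i) y ≤ 1 := hy i
  have h3 : ‖y‖⁻¹ * inner ℝ (u i) y ≤ ‖y‖⁻¹ := by
    have := mul_le_mul_of_nonneg_left h2 (inv_nonneg.2 hyn.le)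
    linarith
  simp only [conj_trivial] at h1
  have h4 : 1 - δ ^ 2 / 2 ≤ ‖y‖⁻¹ := by linarith
  have h5 : (1 - δ ^ 2 / 2) * ‖y‖ ≤ 1 := by
    have := mul_le_mul_of_nonneg_right h4 hyn.le
    rwa [inv_mul_cancel₀ hyn.ne'] at this
  by_contra! hcon
  have h6 : 0 < 1 - δ ^ 2 / 2 := by nlinarith
  have h7 := mul_lt_mul_of_pos_left hcon h6
  nlinarith [mul_nonneg (mul_nonneg hδ0 (sub_nonneg.2 hδ)) (by linarith : 0 ≤ 2 + δ)]

/-- Every hyperplane carries a facet because it touches the sphere at `u i`, where all other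
constraints are strict: distinct unit vectors have inner product below `1`. A small disc about `u i`
then spans all tangential directions. -/
lemma isPolytopeWith_circumscribed (hu : ∀ i, ‖u i‖ = 1) (hinj : Function.Injective u)
    (hδ0 : 0 ≤ δ) (hδ : δ ≤ 1)
    (hnet : ∀ y : EuclideanSpace ℝ (Fin n), ‖y‖ = 1 → ∃ i, ‖y - u i‖ ≤ δ) :
    IsPolytopeWith u (fun _ => 1) (frontier (body u fun _ => 1)) where
  norm_normal := hu
  bounded := isBounded_iff_forall_norm_le.2
    ⟨1 + δ, fun _ hy => norm_le_of_mem_circumscribed hu hδ0 hδ hnet hy⟩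
  interior_nonempty := ⟨0, mem_interior_body fun i => by simp⟩
  facet i := by
    have hu0 : u i ≠ 0 := by intro h0; have := hu i; rw [h0] at this; simp at this
    have hn : 0 < n := by
      rcases Nat.eq_zero_or_pos n with rfl | h
      · exact absurd (Subsingleton.elim _ _) hu0
      · exact h
    set Φ := body u (fun _ => 1) ∩ hyperplane (u i) 1 with hΦ
    have hopen : IsOpen (⋂ k : {k // k ≠ i}, {y | inner ℝ (u k) y < 1}) :=
      isOpen_iInter_of_finite fun k => isOpen_lt (by fun_prop) (by fun_prop)
    have hmem : u i ∈ ⋂ k : {k // k ≠ i}, {y | inner ℝ (u k) y < 1} :=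
      Set.mem_iInter.2 fun k =>
        (inner_lt_one_iff_real_of_norm_eq_one (hu k) (hu i)).2 fun h => k.2 (hinj h)
    obtain ⟨ρ, hρ, hball⟩ := Metric.isOpen_iff.1 hopen _ hmem
    have hdisc : ∀ w, inner ℝ (u i) w = 0 → ‖w‖ < ρ → u i + w ∈ Φ := fun w hw hwn => by
      have h1 : inner ℝ (u i) (u i + w) = 1 := by
        rw [inner_add_right, hw, real_inner_self_eq_norm_sq, hu]; norm_num
      refine ⟨fun k => ?_, h1⟩
      by_cases hk : k = i
      · subst hk; exact h1.le
      · have hin : u i + w ∈ Metric.ball (u i) ρ := by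
          rwa [Metric.mem_ball, dist_eq_norm, add_sub_cancel_left]
        exact le_of_lt (Set.mem_iInter.1 (hball hin) ⟨k, hk⟩)
    have heq : vectorSpan ℝ Φ = (ℝ ∙ u i)ᗮ := by
      refine le_antisymm (vectorSpan_inter_hyperplane_le _ _ _) fun w hw => ?_
      have hw' : inner ℝ (u i) w = 0 := Submodule.mem_orthogonal_singleton_iff_inner_right.1 hw
      set t : ℝ := ρ / 2 / (‖w‖ + 1) with ht
      have hw1 : 0 < ‖w‖ + 1 := by positivity
      have ht0 : 0 < t := by positivity
      have hsmall : ‖t • w‖ < ρ := by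
        rw [norm_smul, Real.norm_of_nonneg ht0.le, ht, div_mul_eq_mul_div, div_lt_iff₀ hw1]
        nlinarith [norm_nonneg w]
      have h1 := hdisc (t • w) (by rw [inner_smul_right, hw', mul_zero]) hsmall
      have h2 := hdisc 0 (by simp) (by simpa using hρ)
      have h3 := vsub_mem_vectorSpan ℝ h1 h2
      rw [vsub_eq_sub, add_sub_add_left_eq_sub, sub_zero] at h3
      have h4 := (vectorSpan ℝ Φ).smul_mem t⁻¹ h3
      rwa [inv_smul_smul₀ ht0.ne'] at h4
    have hfact : Fact (Module.finrank ℝ (EuclideanSpace ℝ (Fin n)) = (n - 1) + 1) :=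
      ⟨by simp; omega⟩
    rw [heq, Submodule.finrank_orthogonal_span_singleton (n := n - 1) hu0]
    omega
  eq_frontier := rfl

/-- Radial projection works both ways: boundary points have norm between `1` and `1 + δ`, and a
point `x` of the sphere reaches the boundary when divided by its largest inner product with a
normal. -/
lemma hausdorffEDist_circumscribed_le (hu : ∀ i, ‖u i‖ = 1) (hδ0 : 0 ≤ δ) (hδ : δ ≤ 1)
    (hnet : ∀ y : EuclideanSpace ℝ (Fin n), ‖y‖ = 1 → ∃ i, ‖y - u i‖ ≤ δ) :
    Metric.hausdorffEDist (frontier (body u fun _ => 1))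
      (Metric.sphere (0 : EuclideanSpace ℝ (Fin n)) 1) ≤ ENNReal.ofReal δ := by
  have hscale : ∀ (x : EuclideanSpace ℝ (Fin n)) (t : ℝ), ‖x‖ = 1 → 1 ≤ t → t ≤ 1 + δ →
      edist (t • x) x ≤ ENNReal.ofReal δ := fun x t hx ht ht' => by
    rw [edist_dist]
    refine ENNReal.ofReal_le_ofReal ?_
    have : t • x - x = (t - 1) • x := by rw [sub_smul, one_smul]
    rw [dist_eq_norm, this, norm_smul, hx, mul_one, Real.norm_of_nonneg (by linarith)]
    linarith
  refine Metric.hausdorffEDist_le_of_mem_edist (fun y hy => ?_) fun x hx => ?_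
  · obtain ⟨hyb, i, hi⟩ := mem_frontier_body hy
    have h1 : 1 ≤ ‖y‖ := by
      have := real_inner_le_norm (u i) y
      rwa [hu i, one_mul, hi] at this
    have h2 := norm_le_of_mem_circumscribed hu hδ0 hδ hnet hyb
    have hyn : ‖y‖ ≠ 0 := by linarith
    have hx1 : ‖‖y‖⁻¹ • y‖ = 1 := by rw [norm_smul, norm_inv, norm_norm, inv_mul_cancel₀ hyn]
    refine ⟨‖y‖⁻¹ • y, by simpa using hx1, ?_⟩
    have := hscale _ _ hx1 h1 h2
    rwa [smul_inv_smul₀ hyn] at this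
  · have hx1 : ‖x‖ = 1 := by simpa using hx
    obtain ⟨i₀, hi₀⟩ := hnet x hx1
    obtain ⟨i, -, hi⟩ := Finset.exists_max_image Finset.univ (fun i => inner ℝ (u i) x)
      ⟨i₀, Finset.mem_univ _⟩
    set μ := inner ℝ (u i) x with hμ
    have hμ0 : 0 < μ := by
      refine lt_of_lt_of_le ?_ (hi i₀ (Finset.mem_univ _))
      have h1 : ‖x - u i₀‖ ^ 2 ≤ δ ^ 2 := pow_le_pow_left₀ (norm_nonneg _) hi₀ 2
      rw [norm_sub_sq_real, hx1, hu, real_inner_comm] at h1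
      nlinarith
    have hμ1 : μ ≤ 1 := by
      have := real_inner_le_norm (u i) x
      rwa [hu i, hx1, one_mul] at this
    have hb : μ⁻¹ • x ∈ body u fun _ => 1 := fun k => by
      rw [inner_smul_right, inv_mul_le_iff₀ hμ0, mul_one]
      exact hi k (Finset.mem_univ _)
    refine ⟨μ⁻¹ • x, mem_frontier_body_of_eq hb (hu i) ?_, ?_⟩
    · rw [inner_smul_right]; exact inv_mul_cancel₀ hμ0.ne'
    · rw [edist_comm]
      refine hscale x _ hx1 ((one_le_inv₀ hμ0).2 hμ1) ?_
      have := norm_le_of_mem_circumscribed hu hδ0 hδ hnet hb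
      rwa [norm_smul, hx1, mul_one, Real.norm_of_nonneg (inv_nonneg.2 hμ0.le)] at this

end Circumscribed

/-- Harmonic polytopes close to the unit sphere. -/
lemma exists_harmonic_near_sphere {n : ℕ} [NeZero n] (hn : 1 < n) {r : ℕ} (hr : 3 ≤ r) :
    ∃ (s : ℕ) (u : Fin s → EuclideanSpace ℝ (Fin n)) (d j : Fin s → ℝ)
      (P : Set (EuclideanSpace ℝ (Fin n))), IsPolytopeWith u d P ∧
      IsHarmonic u d j (2 * r ^ 2 + 1) ∧
      Metric.hausdorffEDist P (Metric.sphere (0 : EuclideanSpace ℝ (Fin n)) 1) ≤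
        ENNReal.ofReal (3 / r) := by
  have hr3 : (3 : ℝ) ≤ r := by exact_mod_cast hr
  obtain ⟨Q, hQ1, hQn, hQc⟩ := exists_sphere_net hn (show 1 ≤ r by omega)
  set u : Fin Q.card → EuclideanSpace ℝ (Fin n) := fun i => (Q.equivFin.symm i).1 with hu
  have huQ : ∀ i, u i ∈ Q := fun i => (Q.equivFin.symm i).2
  have hsurj : ∀ v ∈ Q, ∃ i, u i = v := fun v hv => ⟨Q.equivFin ⟨v, hv⟩, by simp [hu]⟩
  have hu1 : ∀ i, ‖u i‖ = 1 := fun i => hQ1 _ (huQ i)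
  have hinj : Function.Injective u := Subtype.val_injective.comp Q.equivFin.symm.injective
  have hδ0 : (0 : ℝ) ≤ 3 / r := by positivity
  have hδ1 : (3 : ℝ) / r ≤ 1 := by rw [div_le_one (by linarith)]; exact hr3
  have hnet : ∀ y : EuclideanSpace ℝ (Fin n), ‖y‖ = 1 → ∃ i, ‖y - u i‖ ≤ 3 / r := fun y hy => by
    obtain ⟨v, hv, hyv⟩ := hQn y hy
    obtain ⟨i, rfl⟩ := hsurj v hv
    exact ⟨i, hyv⟩
  refine ⟨Q.card, u, fun _ => 1, fun i => u i 0, _,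
    isPolytopeWith_circumscribed hu1 hinj hδ0 hδ1 hnet, ⟨fun _ => one_ne_zero,
      ⟨-1, 1 / (r : ℝ) ^ 2, by positivity, ?_⟩, fun i => mul_one _⟩,
    hausdorffEDist_circumscribed_le hu1 hδ0 hδ1 hnet⟩
  rw [← hQc]
  ext t
  constructor
  · rintro ⟨i, rfl⟩
    exact ⟨u i, huQ i, rfl⟩
  · rintro ⟨v, hv, rfl⟩
    obtain ⟨i, rfl⟩ := hsurj v hv
    exact ⟨i, rfl⟩

/-! ### Centres in the cube -/

lemma unitSegment_subset_unitCube (n : ℕ) [NeZero n] : unitSegment n ⊆ unitCube n := by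
  intro x hx i
  by_cases hi : i = 0
  · rw [hi]; exact hx.1
  · rw [hx.2 i hi]; exact ⟨le_rfl, zero_le_one⟩

lemma hM_le_gM {n : ℕ} [NeZero n] (P : Set (EuclideanSpace ℝ (Fin n))) : hM P ≤ gM P :=
  iInf_mono fun _ => iInf_mono' fun hB =>
    ⟨fun x hx => hB x (unitSegment_subset_unitCube n hx), le_rfl⟩

lemma hP_le_gP {n : ℕ} [NeZero n] (P : Set (EuclideanSpace ℝ (Fin n))) : hP P ≤ gP P :=
  iInf_mono fun _ => iInf_mono' fun hB =>
    ⟨fun x hx => hB x (unitSegment_subset_unitCube n hx), le_rfl⟩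

lemma gP_le_gM {n : ℕ} (P : Set (EuclideanSpace ℝ (Fin n))) : gP P ≤ gM P :=
  leastDimP_le_leastDimM

lemma norm_le_of_mem_unitCube {n : ℕ} {x : EuclideanSpace ℝ (Fin n)} (hx : x ∈ unitCube n) :
    ‖x‖ ≤ n := by
  rcases Nat.eq_zero_or_pos n with rfl | hn
  · rw [Subsingleton.elim x 0]; simp
  have hn' : (1 : ℝ) ≤ n := by exact_mod_cast hn
  have h1 : ‖x‖ ^ 2 ≤ n := by
    rw [EuclideanSpace.norm_sq_eq]
    calc ∑ i, ‖x i‖ ^ 2 ≤ ∑ _i : Fin n, (1 : ℝ) := Finset.sum_le_sum fun i _ => by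
          rw [Real.norm_of_nonneg (hx i).1]
          exact pow_le_one₀ (hx i).1 (hx i).2
      _ = n := by simp
  nlinarith [norm_nonneg x]

lemma gM_le {n : ℕ} (hn : 1 ≤ n) {P : Set (EuclideanSpace ℝ (Fin n))}
    (hP : Bornology.IsBounded P) : gM P ≤ ((n : ℝ) : EReal) := by
  obtain ⟨R, hR⟩ := hP.exists_norm_le
  refine (iInf₂_le (Metric.closedBall 0 (n + R)) fun x hx => ⟨1, one_ne_zero, fun y hy => ?_⟩).trans
    ((boxBound_closedBall hn _).dimM_le (Nat.cast_nonneg n))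
  rw [mem_closedBall_zero_iff, one_smul]
  exact (norm_add_le _ _).trans (add_le_add (norm_le_of_mem_unitCube hx) (hR y hy))

end HarmonicPolytope

open HarmonicPolytope in
theorem mainTheorem4 (n : ℕ) [NeZero n] (hn : 1 < n) :
    (∀ (m s : ℕ) (u : Fin s → EuclideanSpace ℝ (Fin n)) (d j : Fin s → ℝ)
        (P : Set (EuclideanSpace ℝ (Fin n))),
        IsPolytopeWith u d P → IsHarmonic u d j m →
          fM m = fP m ∧
          hM P = (((n : ℝ) - 1 : ℝ) : EReal) + fM m ∧
          hP P = (((n : ℝ) - 1 : ℝ) : EReal) + fM m) ∧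
    ∃ P : ℕ → Set (EuclideanSpace ℝ (Fin n)),
      (∀ k, IsConvexPolytope (P k)) ∧
      Tendsto (fun k => Metric.hausdorffEDist (P k)
        (Metric.sphere (0 : EuclideanSpace ℝ (Fin n)) 1)) atTop (𝓝 0) ∧
      (ArithmeticKakeya ↔ Tendsto (fun k => hM (P k)) atTop (𝓝 (n : EReal))) ∧
      (ArithmeticKakeya ↔ Tendsto (fun k => hP (P k)) atTop (𝓝 (n : EReal))) ∧
      (ArithmeticKakeya → Tendsto (fun k => gM (P k)) atTop (𝓝 (n : EReal))) ∧
      (ArithmeticKakeya → Tendsto (fun k => gP (P k)) atTop (𝓝 (n : EReal))) := by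
  refine ⟨fun m s u d j P hPoly hH =>
    ⟨fM_eq_fP m, hM_eq hn hPoly hH, hP_eq hn hPoly hH⟩, ?_⟩
  -- The shift by `3` keeps the mesh `3 / (k + 3)` at most `1`.
  choose s u d j P hPoly hH hdist using fun k : ℕ =>
    exists_harmonic_near_sphere hn (show 3 ≤ k + 3 by omega)
  have hlen : Tendsto (fun k : ℕ => 2 * (k + 3) ^ 2 + 1) atTop atTop :=
    tendsto_atTop_mono (fun k => show k ≤ 2 * (k + 3) ^ 2 + 1 by nlinarith) tendsto_id
  have hiff : ArithmeticKakeya ↔ Tendsto (fun k : ℕ =>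
      (((n : ℝ) - 1 : ℝ) : EReal) + fM (2 * (k + 3) ^ 2 + 1)) atTop (𝓝 (n : EReal)) := by
    -- Only the lengths `2 * (k + 3) ^ 2 + 1` occur; monotonicity makes the limit along them
    -- equivalent to the full limit.
    rw [arithmeticKakeya_iff, tendsto_iff_tendsto_subseq_of_monotone toReal_fM_mono hlen]
    have h1 : (fun k : ℕ => (((n : ℝ) - 1 : ℝ) : EReal) + fM (2 * (k + 3) ^ 2 + 1)) =
        fun k : ℕ => ((((n : ℝ) - 1) + (fM (2 * (k + 3) ^ 2 + 1)).toReal : ℝ) : EReal) := by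
      funext k
      rw [EReal.coe_add, coe_toReal_fM]
    have h2 : (n : EReal) = (((n : ℝ) - 1 + 1 : ℝ) : EReal) := by
      rw [sub_add_cancel]; rfl
    rw [h1, h2, EReal.tendsto_coe]
    exact (tendsto_const_add_iff ((n : ℝ) - 1)).symm
  have hMiff : ArithmeticKakeya ↔ Tendsto (fun k => hM (P k)) atTop (𝓝 (n : EReal)) := by
    rw [hiff]
    simp only [fun k => hM_eq hn (hPoly k) (hH k)]
  have hPiff : ArithmeticKakeya ↔ Tendsto (fun k => hP (P k)) atTop (𝓝 (n : EReal)) := by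
    rw [hiff]
    simp only [fun k => hP_eq hn (hPoly k) (hH k)]
  have hgle : ∀ k, gM (P k) ≤ (n : EReal) := fun k => by
    refine gM_le hn.le ?_
    rw [(hPoly k).eq_frontier]
    exact (hPoly k).bounded.subset isClosed_body.frontier_subset
  refine ⟨P, fun k => ⟨s k, u k, d k, hPoly k⟩, ?_, hMiff, hPiff, fun h => ?_, fun h => ?_⟩
  · refine tendsto_of_tendsto_of_tendsto_of_le_of_le tendsto_const_nhds ?_ (fun k => zero_le) hdist
    have h1 : Tendsto (fun k : ℕ => (3 : ℝ) / ((k + 3 : ℕ) : ℝ)) atTop (𝓝 0) :=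
      (tendsto_natCast_atTop_atTop.comp (tendsto_add_atTop_nat 3)).const_div_atTop 3
    simpa using ENNReal.tendsto_ofReal h1
  · exact tendsto_of_tendsto_of_tendsto_of_le_of_le (hMiff.1 h) tendsto_const_nhds
      (fun k => hM_le_gM (P k)) hgle
  · exact tendsto_of_tendsto_of_tendsto_of_le_of_le (hPiff.1 h) tendsto_const_nhds
      (fun k => hP_le_gP (P k)) fun k => (gP_le_gM (P k)).trans (hgle k)
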